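/- Let $m$ incoming roads $i\in\mathsf I=\{1,\dots,m\}$, parametrized by $\Omega_i=(-\infty,0]$, and $n$ outgoing roads $j\in\mathsf J=\{m+1,\dots,m+n\}$, parametrized by $\Omega_j=[0,\infty)$, meet at $x=0$; put $\mathsf H=\mathsf I\cup\mathsf J$. Let $\alpha_{i,j}\in(0,1]$ satisfy $\sum_{j\in\mathsf J}\alpha_{i,j}=1$ for every $i\in\mathsf I$. Assume for every $h\in\mathsf H$: (f) $f_h\in C^1([0,1];[0,\infty))$ is strictly concave and $f_h(0)=f_h(1)=0$; (D) $D_h\in C^1([0,1];[0,\infty))$ and $D_h>0$ on $(0,1)$. Consider the system $$\rho_{h,t}+f_h(\rho_h)_x=\bigl(D_h(\rho_h)\rho_{h,x}\bigr)_x,\qquad (t,x)\in\mathbb R\times\Omega_h,\ h\in\mathsf H, \tag{1}$$ coupled through the parabolic fluxes $F_h(u,p)=f_h(u)-D_h(u)\,p$ by $$F_j\bigl(\rho_j(t,0^+),\rho_{j,x}(t,0^+)\bigr)=\sum_{i\in\mathsf I}\alpha_{i,j}\,F_i\bigl(\rho_i(t,0^-),\rho_{i,x}(t,0^-)\bigr)\quad\text{for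 a.e. }t\in\mathbb R,\ j\in\mathsf J, \tag{2}$$ where the values of the fluxes at $0^\pm$ are one-sided limits as $x\to0^\pm$. A *traveling wave* of (1)–(2) is a family $\rho=(\rho_h)_{h\in\mathsf H}$ satisfying (2) such that each $\rho_h:\mathbb R\times\Omega_h\to[0,1]$ is a weak solution of (1) (continuous, $C^1$ almost everywhere, with $D_h(\rho_h)\rho_{h,x}\in L^1_{loc}$) of the form $\rho_h(t,x)=\phi_h(x-c_ht)$, where $c_h\in\mathbb R$ and the profile $\phi_h\in C^0(\mathbb R;[0,1])$ is non-constant, $D_h(\phi_h)\phi_h'\in L^1_{loc}(\mathbb R)$, and $$\int_{\mathbb R}\bigl[D_h(\phi_h)\phi_h'-f_h(\phi_h)+c_h\phi_h\bigr]\psi'\,d\xi=0\quad\text{for all }\psi\in C_c^\infty(\mathbb R).$$ Here, for a continuous function $v$, the product $D_h(v)v'$ (or $D_h(v)v_x$) denotes the weak derivative of $\int_0^{v}D_h(s)\,ds$. The wave is *stationary* if $c_h=0$ for every $h\in\mathsf H$. Given end states $\ell_h^\pm\in[0,1]$ with $\ell_h^-\neq\ell_h^+$, set $$c_h=\frac{f_h(\ell_h^+)-f_h(\ell_h^-)}{\ell_h^+-\ell_h^-},\qquad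 g_h(u)=f_h(u)-c_hu,\qquad \gamma_h(u)=\begin{cases}\dfrac{g_h(u)-g_h(\ell_h^-)}{D_h(u)}&\text{if }D_h(u)\ne0,\\[1ex]0&\text{if }D_h(u)=0,\end{cases}$$ $$\mathsf I_0^c=\{i\in\mathsf I: c_i\neq0\},\qquad L_{i,j}^\pm=\begin{cases}\ell_i^\pm&\text{if }c_ic_j\ge0,\\ \ell_i^\mp&\text{if }c_ic_j<0,\end{cases}$$ and, if $c_j\ne0$, $$c_{i,j}=\frac{c_i}{c_j},\qquad A_{i,j}=\alpha_{i,j}c_{i,j},\qquad k_j=\sum_{i\in\mathsf I_0^c}A_{i,j}L_{i,j}^{\pm}-\ell_j^{\pm}$$ (both signs give the same $k_j$ when (3) below holds). **Theorem.** Problem (1)–(2) admits a non-stationary traveling wave if and only if the following condition holds. ($\mathcal T$) There exist $\ell_i^\pm\in[0,1]$ with $\ell_i^-<\ell_i^+$ for $i\in\mathsf I$, numbers $\ell_j^\pm\in[0,1]$ for $j\in\mathsf J$, and continuous functions $\phi_i:\mathbb R\to[0,1]$, $i\in\mathsf I$, with $\phi_i(\pm\infty)=\ell_i^\pm$ and $D_i(\phi_i)\phi_i'=g_i(\phi_i)-g_i(\ell_i^-)$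 on $\mathbb R$ (where $D_i(\phi_i)\phi_i'$ denotes the derivative of $\int_0^{\phi_i}D_i(s)\,ds$), such that: (i) $\mathsf I_0^c\ne\emptyset$; (ii) for every $j\in\mathsf J$, $$f_j(\ell_j^\pm)=\sum_{i\in\mathsf I}\alpha_{i,j}f_i(L_{i,j}^\pm)\quad\text{(upper signs together and lower signs together)} \tag{3}$$ and $f_j(\ell_j^-)\ne f_j(\ell_j^+)$; (iii) for every $j\in\mathsf J$, with $\ell_j(\xi)=\sum_{i\in\mathsf I_0^c}A_{i,j}\,\phi_i(c_{i,j}\xi)-k_j$, $$\gamma_j\bigl(\ell_j(c_j\xi)\bigr)=\sum_{i\in\mathsf I_0^c}A_{i,j}\,c_{i,j}\,\gamma_i\bigl(\phi_i(c_i\xi)\bigr)\quad\text{for a.e. }\xi\in\mathbb R.$$ -/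

import Mathlib

noncomputable section

namespace StarGraph

open Set Filter Topology MeasureTheory
open scoped ContDiff

/-! ### Flux and diffusivity -/

/-- Condition (f): `f ∈ C¹([0,1]; ℝ₊)` is strictly concave and vanishes at `0` and `1`. -/
structure FluxCondition (f : ℝ → ℝ) : Prop where
  contDiffOn : ContDiffOn ℝ 1 f (Icc 0 1)
  nonneg : ∀ u ∈ Icc (0 : ℝ) 1, 0 ≤ f u
  strictConcaveOn : StrictConcaveOn ℝ (Icc 0 1) f
  zero : f 0 = 0
  one : f 1 = 0

/-- Condition (D): `D ∈ C¹([0,1]; ℝ₊)` is positive on `(0,1)` (it may vanish at `0` and at `1`). -/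
structure DiffusivityCondition (D : ℝ → ℝ) : Prop where
  contDiffOn : ContDiffOn ℝ 1 D (Icc 0 1)
  nonneg : ∀ u ∈ Icc (0 : ℝ) 1, 0 ≤ D u
  pos : ∀ u ∈ Ioo (0 : ℝ) 1, 0 < D u

/-- The primitive `u ↦ ∫₀ᵘ D` of the diffusivity. For a function `v` that is merely continuous,
the diffusion term `D(v) v'` is understood as the derivative of `diffusionPrimitive D ∘ v`. -/
def diffusionPrimitive (D : ℝ → ℝ) (u : ℝ) : ℝ := ∫ s in (0 : ℝ)..u, D s

/-- The parabolic flux `F(u, p) = f(u) - D(u) p`. -/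
def parabolicFlux (f D : ℝ → ℝ) (u p : ℝ) : ℝ := f u - D u * p

/-- The reduced flux `g(u) = f(u) - c u`. -/
def reducedFlux (f : ℝ → ℝ) (c u : ℝ) : ℝ := f u - c * u

/-! ### Traveling waves on a single road -/

/-- `ρ` is a weak solution, with values in `[0,1]`, of `ρ_t + f(ρ)_x = (D(ρ) ρ_x)_x` on `ℝ × Ω`:
it is continuous, it is `C¹` almost everywhere, `D(ρ) ρ_x` is a locally integrable function `w`
(the weak `x`-derivative of the primitive of `D` evaluated at `ρ`), and the equation holds against
every test function in `C_c^∞` of `ℝ × interior Ω`.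
The first variable is the time `t`, the second one the position `x`. -/
structure IsWeakSolution (f D : ℝ → ℝ) (Ω : Set ℝ) (ρ : ℝ → ℝ → ℝ) : Prop where
  mem_Icc : ∀ t, ∀ x ∈ Ω, ρ t x ∈ Icc (0 : ℝ) 1
  continuousOn : ContinuousOn (fun p : ℝ × ℝ => ρ p.1 p.2) (univ ×ˢ Ω)
  ae_contDiffAt : ∀ᵐ p ∂(volume.restrict ((univ : Set ℝ) ×ˢ interior Ω)),
    ContDiffAt ℝ 1 (fun q : ℝ × ℝ => ρ q.1 q.2) p
  weak : ∃ w : ℝ × ℝ → ℝ,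
    LocallyIntegrableOn w (univ ×ˢ interior Ω) volume ∧
    ∀ ψ : ℝ × ℝ → ℝ, ContDiff ℝ ∞ ψ → HasCompactSupport ψ →
      tsupport ψ ⊆ univ ×ˢ interior Ω →
      (∫ p in univ ×ˢ interior Ω,
          diffusionPrimitive D (ρ p.1 p.2) * fderiv ℝ ψ p (0, 1)
        = - ∫ p in univ ×ˢ interior Ω, w p * ψ p) ∧
      ∫ p in univ ×ˢ interior Ω,
          (ρ p.1 p.2 * fderiv ℝ ψ p (1, 0)
            + (f (ρ p.1 p.2) - w p) * fderiv ℝ ψ p (0, 1)) = 0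

/-- `φ : ℝ → [0,1]` is a weak solution of the profile equation
`(D(φ) φ')' - g'(φ) φ' = 0` on `ℝ`, with `g(u) = f(u) - c u`:
`φ` is continuous, `D(φ) φ'` is a locally integrable function `w`, and
`∫ (D(φ) φ' - g(φ)) ψ' = 0` for every test function `ψ`. -/
structure IsWeakProfile (f D : ℝ → ℝ) (c : ℝ) (φ : ℝ → ℝ) : Prop where
  mem_Icc : ∀ ξ, φ ξ ∈ Icc (0 : ℝ) 1
  continuous : Continuous φ
  weak : ∃ w : ℝ → ℝ, LocallyIntegrable w volume ∧
    ∀ ψ : ℝ → ℝ, ContDiff ℝ ∞ ψ → HasCompactSupport ψ →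
      (∫ ξ, diffusionPrimitive D (φ ξ) * deriv ψ ξ = - ∫ ξ, w ξ * ψ ξ) ∧
      ∫ ξ, (w ξ - reducedFlux f c (φ ξ)) * deriv ψ ξ = 0

/-- `ρ` is a traveling-wave solution of `ρ_t + f(ρ)_x = (D(ρ) ρ_x)_x` on `ℝ × Ω`, with
(non-constant) profile `φ` and speed `c`. -/
structure IsTravelingWaveSolution (f D : ℝ → ℝ) (Ω : Set ℝ) (ρ : ℝ → ℝ → ℝ)
    (φ : ℝ → ℝ) (c : ℝ) : Prop where
  weakSolution : IsWeakSolution f D Ω ρ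
  eq_profile : ∀ t, ∀ x ∈ Ω, ρ t x = φ (x - c * t)
  nonconstant : ¬ ∃ a : ℝ, ∀ ξ, φ ξ = a
  weakProfile : IsWeakProfile f D c φ

/-- `φ : ℝ → [0,1]` is continuous, has the limits `φ(±∞) = ℓ^±` and satisfies
`D(φ(ξ)) φ'(ξ) = g(φ(ξ)) - g(ℓ⁻)` for every `ξ`, where `g(u) = f(u) - c u`. -/
structure IsProfile (f D : ℝ → ℝ) (c lm lp : ℝ) (φ : ℝ → ℝ) : Prop where
  mem_Icc : ∀ ξ, φ ξ ∈ Icc (0 : ℝ) 1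
  continuous : Continuous φ
  tendsto_atBot : Tendsto φ atBot (𝓝 lm)
  tendsto_atTop : Tendsto φ atTop (𝓝 lp)
  equation : ∀ ξ, HasDerivAt (fun η => diffusionPrimitive D (φ η))
    (reducedFlux f c (φ ξ) - reducedFlux f c lm) ξ

/-! ### Traveling waves in the network

The incoming roads are indexed by `Fin m` (through `Sum.inl`), the outgoing ones by `Fin n`
(through `Sum.inr`). -/

variable {m n : ℕ}

/-- The roads: `(-∞, 0]` for the incoming ones and `[0, ∞)` for the outgoing ones. -/
def road : Fin m ⊕ Fin n → Set ℝ
  | Sum.inl _ => Iic 0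
  | Sum.inr _ => Ici 0

/-- The parabolic flux `F_h(ρ_h, ρ_{h,x})` of `ρ` on the road `h` at time `t` and position `x`. -/
def fluxAt (f D : Fin m ⊕ Fin n → ℝ → ℝ) (ρ : Fin m ⊕ Fin n → ℝ → ℝ → ℝ)
    (h : Fin m ⊕ Fin n) (t x : ℝ) : ℝ :=
  parabolicFlux (f h) (D h) (ρ h t x) (deriv (ρ h t) x)

/-- The conservation of the parabolic flux at the crossroad: for every outgoing road `j`,
for a.e. `t`, the trace at `0⁺` of the flux of road `j` is the sum over the incoming roads `i` of
`α i j` times the trace `q i` at `0⁻` of the flux of road `i`. -/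
def FluxConservation (f D : Fin m ⊕ Fin n → ℝ → ℝ) (α : Fin m → Fin n → ℝ)
    (ρ : Fin m ⊕ Fin n → ℝ → ℝ → ℝ) : Prop :=
  ∀ j : Fin n, ∀ᵐ t : ℝ, ∃ q : Fin m → ℝ,
    (∀ i, Tendsto (fluxAt f D ρ (Sum.inl i) t) (𝓝[<] 0) (𝓝 (q i))) ∧
    Tendsto (fluxAt f D ρ (Sum.inr j) t) (𝓝[>] 0) (𝓝 (∑ i, α i j * q i))

/-- `ρ` is a traveling wave in the network, with profiles `φ h` and speeds `c h`. -/
structure IsTravelingWave (f D : Fin m ⊕ Fin n → ℝ → ℝ) (α : Fin m → Fin n → ℝ)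
    (ρ : Fin m ⊕ Fin n → ℝ → ℝ → ℝ) (φ : Fin m ⊕ Fin n → ℝ → ℝ)
    (c : Fin m ⊕ Fin n → ℝ) : Prop where
  travelingWaveSolution : ∀ h, IsTravelingWaveSolution (f h) (D h) (road h) (ρ h) (φ h) (c h)
  fluxConservation : FluxConservation f D α ρ

/-- A traveling wave with speeds `c h` is stationary if every component is stationary. -/
def IsStationary (c : Fin m ⊕ Fin n → ℝ) : Prop := ∀ h, c h = 0

/-! ### The quantities attached to the end states

Below, `lm h` and `lp h` are the end states `ℓ_h⁻` and `ℓ_h⁺`. -/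

/-- The speeds `c_h = (f_h(ℓ_h⁺) - f_h(ℓ_h⁻)) / (ℓ_h⁺ - ℓ_h⁻)`. -/
def speed (f : Fin m ⊕ Fin n → ℝ → ℝ) (lm lp : Fin m ⊕ Fin n → ℝ) (h : Fin m ⊕ Fin n) : ℝ :=
  (f h (lp h) - f h (lm h)) / (lp h - lm h)

/-- `L_{i,j}⁺`: equal to `ℓ_i⁺` if `c_i c_j ≥ 0` and to `ℓ_i⁻` if `c_i c_j < 0`. -/
def Lplus (f : Fin m ⊕ Fin n → ℝ → ℝ) (lm lp : Fin m ⊕ Fin n → ℝ) (i : Fin m) (j : Fin n) : ℝ :=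
  if 0 ≤ speed f lm lp (Sum.inl i) * speed f lm lp (Sum.inr j)
    then lp (Sum.inl i) else lm (Sum.inl i)

/-- `L_{i,j}⁻`: equal to `ℓ_i⁻` if `c_i c_j ≥ 0` and to `ℓ_i⁺` if `c_i c_j < 0`. -/
def Lminus (f : Fin m ⊕ Fin n → ℝ → ℝ) (lm lp : Fin m ⊕ Fin n → ℝ) (i : Fin m) (j : Fin n) : ℝ :=
  if 0 ≤ speed f lm lp (Sum.inl i) * speed f lm lp (Sum.inr j)
    then lm (Sum.inl i) else lp (Sum.inl i)

/-- The set of the incoming roads with non-zero speed. -/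
def movingIncoming (f : Fin m ⊕ Fin n → ℝ → ℝ) (lm lp : Fin m ⊕ Fin n → ℝ) : Finset (Fin m) :=
  Finset.univ.filter fun i => speed f lm lp (Sum.inl i) ≠ 0

/-- `c_{i,j} = c_i / c_j`. -/
def speedRatio (f : Fin m ⊕ Fin n → ℝ → ℝ) (lm lp : Fin m ⊕ Fin n → ℝ)
    (i : Fin m) (j : Fin n) : ℝ :=
  speed f lm lp (Sum.inl i) / speed f lm lp (Sum.inr j)

/-- `A_{i,j} = α_{i,j} c_{i,j}`. -/
def coeffA (f : Fin m ⊕ Fin n → ℝ → ℝ) (α : Fin m → Fin n → ℝ) (lm lp : Fin m ⊕ Fin n → ℝ)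
    (i : Fin m) (j : Fin n) : ℝ :=
  α i j * speedRatio f lm lp i j

/-- `k_j = ∑ A_{i,j} L_{i,j}^± - ℓ_j^±`, the sum being over the incoming roads with non-zero
speed. It is written here with the upper signs; the lower signs give the same value whenever
`f_j(ℓ_j^±) = ∑ α_{i,j} f_i(L_{i,j}^±)` and `c_j ≠ 0`. -/
def coeffK (f : Fin m ⊕ Fin n → ℝ → ℝ) (α : Fin m → Fin n → ℝ) (lm lp : Fin m ⊕ Fin n → ℝ)
    (j : Fin n) : ℝ :=
  ∑ i ∈ movingIncoming f lm lp, coeffA f α lm lp i j * Lplus f lm lp i j - lp (Sum.inr j)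

/-- The candidate outgoing profile `ℓ_j(ξ) = ∑ A_{i,j} φ_i(c_{i,j} ξ) - k_j`. -/
def candidate (f : Fin m ⊕ Fin n → ℝ → ℝ) (α : Fin m → Fin n → ℝ) (lm lp : Fin m ⊕ Fin n → ℝ)
    (φ : Fin m → ℝ → ℝ) (j : Fin n) (ξ : ℝ) : ℝ :=
  ∑ i ∈ movingIncoming f lm lp, coeffA f α lm lp i j * φ i (speedRatio f lm lp i j * ξ)
    - coeffK f α lm lp j

/-- The quotient `(g_h(u) - g_h(ℓ_h⁻)) / D_h(u)`, extended by `0` where `D_h(u) = 0`; here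
`g_h(u) = f_h(u) - c_h u`. -/
def slope (f D : Fin m ⊕ Fin n → ℝ → ℝ) (lm lp : Fin m ⊕ Fin n → ℝ) (h : Fin m ⊕ Fin n)
    (u : ℝ) : ℝ :=
  if D h u = 0 then 0
  else (reducedFlux (f h) (speed f lm lp h) u - reducedFlux (f h) (speed f lm lp h) (lm h)) / D h u

/-- Condition (T). -/
def ConditionT (f D : Fin m ⊕ Fin n → ℝ → ℝ) (α : Fin m → Fin n → ℝ) : Prop :=
  ∃ (lm lp : Fin m ⊕ Fin n → ℝ) (φ : Fin m → ℝ → ℝ),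
    -- the incoming end states
    (∀ i : Fin m, lm (Sum.inl i) ∈ Icc (0 : ℝ) 1 ∧ lp (Sum.inl i) ∈ Icc (0 : ℝ) 1 ∧
      lm (Sum.inl i) < lp (Sum.inl i)) ∧
    -- some incoming speed is non-zero
    (movingIncoming f lm lp).Nonempty ∧
    -- the outgoing end states
    (∀ j : Fin n, lm (Sum.inr j) ∈ Icc (0 : ℝ) 1 ∧ lp (Sum.inr j) ∈ Icc (0 : ℝ) 1 ∧
      f (Sum.inr j) (lm (Sum.inr j))
        = ∑ i, α i j * f (Sum.inl i) (Lminus f lm lp i j) ∧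
      f (Sum.inr j) (lp (Sum.inr j))
        = ∑ i, α i j * f (Sum.inl i) (Lplus f lm lp i j) ∧
      f (Sum.inr j) (lm (Sum.inr j)) ≠ f (Sum.inr j) (lp (Sum.inr j))) ∧
    -- the incoming profiles
    (∀ i : Fin m, IsProfile (f (Sum.inl i)) (D (Sum.inl i)) (speed f lm lp (Sum.inl i))
      (lm (Sum.inl i)) (lp (Sum.inl i)) (φ i)) ∧
    -- the compatibility identity
    ∀ j : Fin n, ∀ᵐ ξ : ℝ,
      slope f D lm lp (Sum.inr j) (candidate f α lm lp φ j (speed f lm lp (Sum.inr j) * ξ))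
        = ∑ i ∈ movingIncoming f lm lp,
            coeffA f α lm lp i j * speedRatio f lm lp i j *
              slope f D lm lp (Sum.inl i) (φ i (speed f lm lp (Sum.inl i) * ξ))

end StarGraph

end

/-!
A non-constant profile on a single road can be integrated once. By the lemma of du Bois-Reymond,
`IsWeakProfile` means that `P(φ)' = g(φ) - K` holds classically, where `P` is the primitive of the
diffusivity and `K` a constant. Since `g - K` is concave, a negative value of it along the profile
would persist in the future or in the past and make the bounded function `P(φ)` unbounded; hence
`φ` is non-decreasing, it has limits `ℓ⁻ < ℓ⁺`, and `c` is the slope of the chord of `f` between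
them (`IsWeakProfile.exists_isProfile`). Because `P` is a diffeomorphism away from `0` and `1`, and
`φ` is extremal where it takes these values, `D(φ) φ' = g(φ) - g(ℓ⁻)` holds pointwise
(`IsProfile.mul_deriv`), and `φ` is `C¹` outside a countable set. In particular the parabolic flux
along `ρ(t, x) = φ(x - c t)` equals `c φ(x - c t) + g(ℓ⁻)`, so that the conservation of the flux at
the crossroad reads

`c_j φ_j(c_j s) + g_j(ℓ_j⁻) = ∑ α_{i,j} (c_i φ_i(c_i s) + g_i(ℓ_i⁻))` for all `s`.

From traveling waves to the condition: each `c_i φ_i(c_i s)` is non-decreasing in `s` whatever the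
sign of `c_i`, so the right-hand side is non-constant as soon as one `c_i` is not zero; a
non-stationary wave therefore has some `c_i ≠ 0` and all `c_j ≠ 0`. The limits `s → ±∞` of the
identity are the relations between the end states, solving it for `φ_j` shows that `φ_j` is the
candidate profile, and differentiating it almost everywhere is the compatibility identity
(`IsTravelingWave.conditionT`).

From the condition to traveling waves: the candidate is monotone with limits `ℓ_j^±`, and it is
differentiable outside a countable set, with the derivative prescribed by the compatibility
identity. The fundamental theorem of calculus with a countable exceptional set makes it a profile
(`IsProfile.of_ae`, `isProfile_candidate`). A profile gives a weak solution on `ℝ × Ω` through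
integration by parts along the direction `(0, 1)` for `P(φ)`, and along the direction `(1, c)`, in
which `φ(x - c t)` is constant (`IsProfile.isTravelingWaveSolution`).
-/

noncomputable section

namespace StarGraph

open Set Filter Topology MeasureTheory
open scoped ContDiff

/-! ### The lemma of du Bois-Reymond -/

theorem exists_contDiff_hasCompactSupport_deriv_eq {θ : ℝ → ℝ} (hθ : ContDiff ℝ ∞ θ)
    (hc : HasCompactSupport θ) (h0 : ∫ x, θ x = 0) :
    ∃ ψ : ℝ → ℝ, ContDiff ℝ ∞ ψ ∧ HasCompactSupport ψ ∧ deriv ψ = θ := by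
  obtain ⟨R, hR⟩ := hc.isCompact.isBounded.subset_closedBall (0 : ℝ)
  have hsupp : ∀ x, R < |x| → θ x = 0 := fun x hx => by
    by_contra hne
    have := hR (subset_tsupport _ hne)
    simp only [Metric.mem_closedBall, dist_zero_right, Real.norm_eq_abs] at this
    linarith
  have hd : ∀ x, HasDerivAt (fun y => ∫ t in (-R - 1)..y, θ t) (θ x) x := fun x =>
    hθ.continuous.integral_hasStrictDerivAt _ x |>.hasDerivAt
  have hderiv : deriv (fun y => ∫ t in (-R - 1)..y, θ t) = θ := funext fun x => (hd x).deriv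
  refine ⟨fun y => ∫ t in (-R - 1)..y, θ t, ?_, ?_, hderiv⟩
  · rw [contDiff_infty_iff_deriv, hderiv]
    exact ⟨fun x => (hd x).differentiableAt, hθ⟩
  · refine HasCompactSupport.of_support_subset_isCompact (isCompact_Icc (a := -|R| - 1)
      (b := |R| + 1)) fun x hx => ?_
    by_contra hx'
    refine hx ?_
    have hRR := le_abs_self R
    have hRn := abs_nonneg R
    rw [mem_Icc, not_and_or, not_le, not_le] at hx'
    rcases hx' with hx' | hx'
    · have : ∀ t ∈ uIcc (-R - 1) x, θ t = 0 := fun t ht => by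
        rw [uIcc_of_ge (by linarith)] at ht
        refine hsupp t (lt_abs.2 (Or.inr ?_))
        linarith [ht.2]
      simpa using intervalIntegral.integral_congr (g := fun _ => (0 : ℝ)) this
    · show ∫ t in (-R - 1)..x, θ t = 0
      rw [intervalIntegral.integral_eq_integral_of_support_subset, h0]
      intro t ht
      have : ¬ R < |t| := fun h => ht (hsupp t h)
      have := abs_le.1 (not_lt.1 this)
      exact ⟨by linarith, by linarith⟩

theorem exists_ae_eq_const_of_integral_mul_deriv_eq_zero {u : ℝ → ℝ}
    (hu : LocallyIntegrable u volume)
    (h : ∀ ψ : ℝ → ℝ, ContDiff ℝ ∞ ψ → HasCompactSupport ψ → ∫ ξ, u ξ * deriv ψ ξ = 0) :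
    ∃ C : ℝ, ∀ᵐ ξ, u ξ = C := by
  let b : ContDiffBump (0 : ℝ) := ⟨1, 2, one_pos, one_lt_two⟩
  set η : ℝ → ℝ := b.normed volume
  have hη : ContDiff ℝ ∞ η := b.contDiff_normed
  have hηc : HasCompactSupport η := b.hasCompactSupport_normed
  have hint : ∀ θ : ℝ → ℝ, ContDiff ℝ ∞ θ → HasCompactSupport θ →
      Integrable fun ξ => u ξ * θ ξ := fun θ h1 h2 => by
    simpa [mul_comm] using hu.integrable_smul_left_of_hasCompactSupport h1.continuous h2
  refine ⟨∫ ξ, u ξ * η ξ, ?_⟩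
  set C := ∫ ξ, u ξ * η ξ with hC
  have hz : ∀ᵐ ξ, u ξ - C = 0 := by
    refine ae_eq_zero_of_integral_contDiff_smul_eq_zero
      (hu.sub (locallyIntegrable_const C)) fun θ hθ hθc => ?_
    have hθi : Integrable θ := hθ.continuous.integrable_of_hasCompactSupport hθc
    have hηi : Integrable η := hη.continuous.integrable_of_hasCompactSupport hηc
    -- subtracting a multiple of the bump `η` makes the mean of `θ` vanish
    obtain ⟨ψ, h1, h2, h3⟩ := exists_contDiff_hasCompactSupport_deriv_eq
      (θ := fun x => θ x - (∫ y, θ y) * η x) (hθ.sub (contDiff_const.mul hη))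
      (hθc.sub (hηc.mul_left)) (by
        rw [integral_sub hθi (hηi.const_mul _), integral_const_mul, b.integral_normed]; ring)
    have h4 := h ψ h1 h2
    rw [h3] at h4
    have h5 : (∫ ξ, u ξ * θ ξ) - (∫ y, θ y) * C = 0 := by
      rw [hC, ← integral_const_mul, ← integral_sub (hint θ hθ hθc) ((hint η hη hηc).const_mul _),
        ← h4]
      congr 1; ext ξ; ring
    calc ∫ ξ, θ ξ • (u ξ - C) = ∫ ξ, (u ξ * θ ξ - C * θ ξ) := by
          congr 1; ext ξ; simp only [smul_eq_mul]; ring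
      _ = (∫ ξ, u ξ * θ ξ) - (∫ y, θ y) * C := by
          rw [integral_sub (hint θ hθ hθc) (hθi.const_mul _), integral_const_mul]; ring
      _ = 0 := h5
  filter_upwards [hz] with ξ hξ
  linarith

/-! ### The primitive of the diffusivity -/

section SingleRoad

variable {f D φ : ℝ → ℝ} {c lm lp K : ℝ}

theorem DiffusivityCondition.hasDerivWithinAt_primitive (hD : DiffusivityCondition D) {u : ℝ}
    (hu : u ∈ Icc (0 : ℝ) 1) :
    HasDerivWithinAt (diffusionPrimitive D) (D u) (Icc 0 1) u := by
  -- outside `[0,1]` nothing is known on `D`, so it is replaced by its constant extension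
  have hcont : Continuous (IccExtend (zero_le_one' ℝ) (fun x : Icc (0 : ℝ) 1 => D x)) :=
    (continuousOn_iff_continuous_domRestrict.1 hD.contDiffOn.continuousOn).Icc_extend'
  have h1 := (hcont.integral_hasStrictDerivAt 0 u).hasDerivAt.hasDerivWithinAt (s := Icc 0 1)
  rw [IccExtend_of_mem _ _ hu] at h1
  have heq : ∀ y ∈ Icc (0 : ℝ) 1, diffusionPrimitive D y =
      ∫ s in (0 : ℝ)..y, IccExtend (zero_le_one' ℝ) (fun x : Icc (0 : ℝ) 1 => D x) s := by
    intro y hy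
    refine intervalIntegral.integral_congr fun s hs => ?_
    rw [uIcc_of_le hy.1] at hs
    exact (IccExtend_of_mem _ (fun x : Icc (0 : ℝ) 1 => D x) ⟨hs.1, hs.2.trans hy.2⟩).symm
  exact h1.congr heq (heq u hu)

theorem DiffusivityCondition.continuousOn_primitive (hD : DiffusivityCondition D) :
    ContinuousOn (diffusionPrimitive D) (Icc 0 1) :=
  fun _ hu => (hD.hasDerivWithinAt_primitive hu).continuousWithinAt

theorem DiffusivityCondition.hasDerivAt_primitive (hD : DiffusivityCondition D) {u : ℝ}
    (hu : u ∈ Ioo (0 : ℝ) 1) : HasDerivAt (diffusionPrimitive D) (D u) u :=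
  (hD.hasDerivWithinAt_primitive (Ioo_subset_Icc_self hu)).hasDerivAt (Icc_mem_nhds hu.1 hu.2)

theorem DiffusivityCondition.strictMonoOn_primitive (hD : DiffusivityCondition D) :
    StrictMonoOn (diffusionPrimitive D) (Icc 0 1) := by
  refine strictMonoOn_of_deriv_pos (convex_Icc 0 1) hD.continuousOn_primitive fun u hu => ?_
  rw [interior_Icc] at hu
  rw [(hD.hasDerivAt_primitive hu).deriv]
  exact hD.pos u hu

theorem DiffusivityCondition.continuous_comp_primitive (hD : DiffusivityCondition D)
    (h01 : ∀ ξ, φ ξ ∈ Icc (0 : ℝ) 1) (hφ : Continuous φ) :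
    Continuous fun ξ => diffusionPrimitive D (φ ξ) :=
  hD.continuousOn_primitive.comp_continuous hφ h01

theorem FluxCondition.continuousOn_reducedFlux (hf : FluxCondition f) (c : ℝ) :
    ContinuousOn (reducedFlux f c) (Icc 0 1) :=
  hf.contDiffOn.continuousOn.sub (by fun_prop)

theorem FluxCondition.continuous_reducedFlux_comp (hf : FluxCondition f)
    (h01 : ∀ ξ, φ ξ ∈ Icc (0 : ℝ) 1) (hφ : Continuous φ) :
    Continuous fun ξ => reducedFlux f c (φ ξ) :=
  (hf.continuousOn_reducedFlux c).comp_continuous hφ h01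

theorem FluxCondition.strictConcaveOn_reducedFlux (hf : FluxCondition f) (c : ℝ) :
    StrictConcaveOn ℝ (Icc 0 1) (reducedFlux f c) := by
  refine ⟨convex_Icc 0 1, fun x hx y hy hxy a b ha hb hab => ?_⟩
  have := hf.strictConcaveOn.2 hx hy hxy ha hb hab
  simp only [smul_eq_mul, reducedFlux] at this ⊢
  linarith

/-! ### Regularity and monotonicity of the profiles -/

/-- The profile equation can be integrated once: a weak profile solves, in the classical sense, a
first order equation for `diffusionPrimitive D ∘ φ`. -/
theorem IsWeakProfile.exists_hasDerivAt (hf : FluxCondition f) (hD : DiffusivityCondition D)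
    (hφ : IsWeakProfile f D c φ) :
    ∃ K : ℝ, ∀ ξ, HasDerivAt (fun η => diffusionPrimitive D (φ η))
      (reducedFlux f c (φ ξ) - K) ξ := by
  obtain ⟨w, hw, hweak⟩ := hφ.weak
  have hg := hf.continuous_reducedFlux_comp (c := c) hφ.mem_Icc hφ.continuous
  have hP := hD.continuous_comp_primitive hφ.mem_Icc hφ.continuous
  obtain ⟨C, hC⟩ := exists_ae_eq_const_of_integral_mul_deriv_eq_zero
    (hw.sub hg.locallyIntegrable) fun ψ h1 h2 => (hweak ψ h1 h2).2
  have hv : Continuous fun ξ => reducedFlux f c (φ ξ) + C := hg.add continuous_const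
  have hVd : ∀ ξ, HasDerivAt (fun y => ∫ t in (0 : ℝ)..y, (reducedFlux f c (φ t) + C))
      (reducedFlux f c (φ ξ) + C) ξ := fun ξ => (hv.integral_hasStrictDerivAt 0 ξ).hasDerivAt
  set V : ℝ → ℝ := fun y => ∫ t in (0 : ℝ)..y, (reducedFlux f c (φ t) + C) with hV
  have hVc : Continuous V := continuous_iff_continuousAt.2 fun ξ => (hVd ξ).continuousAt
  have hint : ∀ (u ψ : ℝ → ℝ), Continuous u → Continuous ψ → HasCompactSupport ψ →
      Integrable fun ξ => u ξ * ψ ξ := fun u ψ h1 h2 h3 =>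
    (h1.mul h2).integrable_of_hasCompactSupport h3.mul_left
  obtain ⟨B, hB⟩ := exists_ae_eq_const_of_integral_mul_deriv_eq_zero
    (u := fun ξ => diffusionPrimitive D (φ ξ) - V ξ) (hP.sub hVc).locallyIntegrable
    fun ψ h1 h2 => by
      have hψ' : Continuous (deriv ψ) := h1.continuous_deriv (by simp)
      have e1 : ∫ ξ, V ξ * deriv ψ ξ = - ∫ ξ, (reducedFlux f c (φ ξ) + C) * ψ ξ :=
        integral_mul_deriv_eq_deriv_mul_of_integrable (fun x _ => hVd x)
          (fun x _ => (h1.differentiable (by simp) x).hasDerivAt)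
          (hint _ _ hVc hψ' h2.deriv) (hint _ _ hv h1.continuous h2)
          (hint _ _ hVc h1.continuous h2)
      have e2 : ∫ ξ, w ξ * ψ ξ = ∫ ξ, (reducedFlux f c (φ ξ) + C) * ψ ξ := by
        refine integral_congr_ae ?_
        filter_upwards [hC] with ξ hξ
        have : w ξ = reducedFlux f c (φ ξ) + C := by
          simp only [Pi.sub_apply] at hξ; linarith
        rw [this]
      simp only [sub_mul]
      rw [integral_sub (hint _ _ hP hψ' h2.deriv) (hint _ _ hVc hψ' h2.deriv),
        (hweak ψ h1 h2).1, e1, e2, sub_self]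
  have hall : (fun ξ => diffusionPrimitive D (φ ξ) - V ξ) = fun _ => B :=
    (hP.sub hVc).ae_eq_iff_eq volume continuous_const |>.1 hB
  refine ⟨-C, fun ξ => ?_⟩
  have hfun : (fun η => diffusionPrimitive D (φ η)) = fun η => V η + B := by
    ext η; have := congrFun hall η; linarith
  rw [hfun, sub_neg_eq_add]
  exact (hVd ξ).add_const B

/-- A function whose derivative is at most `-δ < 0` wherever the function does not exceed its value
at `ξ₀` never returns to that value after `ξ₀`, and is unbounded below. -/
theorem exists_lt_of_deriv_le {v v' : ℝ → ℝ} {ξ₀ δ : ℝ} (hδ : 0 < δ)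
    (hv : ∀ ξ, HasDerivAt v (v' ξ) ξ) (h : ∀ ξ, v ξ ≤ v ξ₀ → v' ξ ≤ -δ) (m : ℝ) :
    ∃ ξ, v ξ < m := by
  have hcont : Continuous v := continuous_iff_continuousAt.2 fun ξ => (hv ξ).continuousAt
  have hle : ∀ ξ, ξ₀ ≤ ξ → v ξ ≤ v ξ₀ := fun ξ hξ =>
    image_le_of_deriv_right_lt_deriv_boundary (a := ξ₀) (b := ξ) (B := fun _ => v ξ₀)
      (B' := fun _ => 0)
      hcont.continuousOn (fun x _ => (hv x).hasDerivWithinAt) le_rfl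
      (fun x => hasDerivAt_const x _) (fun x _ hx => by linarith [h x hx.le]) ⟨hξ, le_rfl⟩
  have hlin : ∀ ξ, ξ₀ ≤ ξ → v ξ ≤ v ξ₀ - δ * (ξ - ξ₀) := by
    intro ξ hξ
    have hmono : AntitoneOn (fun x => v x + δ * x) (Ici ξ₀) := by
      refine antitoneOn_of_deriv_nonpos (convex_Ici ξ₀)
        (hcont.add (by fun_prop)).continuousOn
        (fun x _ => ((hv x).add
          ((hasDerivAt_id x).const_mul δ)).differentiableAt.differentiableWithinAt)
        fun x hx => ?_
      rw [interior_Ici] at hx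
      have hd : HasDerivAt (fun x => v x + δ * x) (v' x + δ * 1) x :=
        (hv x).add ((hasDerivAt_id x).const_mul δ)
      rw [hd.deriv]
      linarith [h x (hle x (le_of_lt hx))]
    have := hmono (mem_Ici.2 le_rfl) (mem_Ici.2 hξ) hξ
    simp only at this
    linarith
  obtain ⟨T, hT⟩ := exists_gt (max 0 ((v ξ₀ - m) / δ))
  refine ⟨ξ₀ + T, ?_⟩
  have h1 := hlin (ξ₀ + T) (by linarith [le_max_left 0 ((v ξ₀ - m) / δ)])
  have h2 : (v ξ₀ - m) / δ < T := lt_of_le_of_lt (le_max_right _ _) hT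
  rw [div_lt_iff₀ hδ] at h2
  have h3 : δ * (ξ₀ + T - ξ₀) = T * δ := by ring
  linarith

/-- If `g(φ) - K` were negative somewhere, concavity would keep it below a negative constant on
one side of that value, and `diffusionPrimitive D ∘ φ` would be unbounded. -/
theorem reducedFlux_sub_nonneg (hf : FluxCondition f) (hD : DiffusivityCondition D)
    (h01 : ∀ ξ, φ ξ ∈ Icc (0 : ℝ) 1)
    (hd : ∀ ξ, HasDerivAt (fun η => diffusionPrimitive D (φ η)) (reducedFlux f c (φ ξ) - K) ξ)
    (ξ : ℝ) : 0 ≤ reducedFlux f c (φ ξ) - K := by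
  by_contra! hneg
  set u₀ := φ ξ with hu₀
  have hg := hf.continuousOn_reducedFlux c
  have hcv := (hf.strictConcaveOn_reducedFlux c).concaveOn
  have h0 : (0 : ℝ) ∈ Icc (0 : ℝ) 1 := by simp
  have h1 : (1 : ℝ) ∈ Icc (0 : ℝ) 1 := by simp
  have hlow : ∀ η, diffusionPrimitive D 0 ≤ diffusionPrimitive D (φ η) := fun η =>
    hD.strictMonoOn_primitive.monotoneOn h0 (h01 η) (h01 η).1
  have hup : ∀ η, diffusionPrimitive D (φ η) ≤ diffusionPrimitive D 1 := fun η =>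
    hD.strictMonoOn_primitive.monotoneOn (h01 η) h1 (h01 η).2
  have hside : (∀ u ∈ Icc 0 u₀, reducedFlux f c u < K) ∨
      (∀ u ∈ Icc u₀ 1, reducedFlux f c u < K) := by
    by_contra! hcon
    obtain ⟨⟨a, ha, hKa⟩, b, hb, hKb⟩ := hcon
    have hmin := hcv.min_le_of_mem_Icc (x := a) (y := b) (z := u₀)
      ⟨ha.1, ha.2.trans (h01 ξ).2⟩ ⟨(h01 ξ).1.trans hb.1, hb.2⟩ ⟨ha.2, hb.1⟩
    linarith [le_min hKa hKb]
  rcases hside with hside | hside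
  · obtain ⟨x, hx, hmax⟩ := isCompact_Icc.exists_isMaxOn ⟨u₀, right_mem_Icc.2 (h01 ξ).1⟩
      (hg.mono (Icc_subset_Icc_right (h01 ξ).2))
    obtain ⟨η, hη⟩ := exists_lt_of_deriv_le (ξ₀ := ξ) (sub_pos.2 (hside x hx)) hd
      (fun η hη => by
        have : φ η ≤ u₀ := (hD.strictMonoOn_primitive.le_iff_le (h01 η) (h01 ξ)).1 hη
        have : reducedFlux f c (φ η) ≤ reducedFlux f c x := hmax ⟨(h01 η).1, this⟩
        linarith) (diffusionPrimitive D 0)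
    exact absurd hη (not_lt.2 (hlow η))
  · obtain ⟨x, hx, hmax⟩ := isCompact_Icc.exists_isMaxOn ⟨u₀, left_mem_Icc.2 (h01 ξ).2⟩
      (hg.mono (Icc_subset_Icc_left (h01 ξ).1))
    -- the reflection `η ↦ -v (-η)` reduces the growth in the past to the first case
    have hd' : ∀ η, HasDerivAt (fun η => -diffusionPrimitive D (φ (-η)))
        (reducedFlux f c (φ (-η)) - K) η := fun η => by
      have := ((hd (-η)).scomp η (hasDerivAt_neg η)).fun_neg
      simpa [Function.comp_def] using this
    obtain ⟨η, hη⟩ := exists_lt_of_deriv_le (ξ₀ := -ξ) (sub_pos.2 (hside x hx)) hd'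
      (fun η hη => by
        rw [neg_neg, neg_le_neg_iff] at hη
        have : u₀ ≤ φ (-η) := (hD.strictMonoOn_primitive.le_iff_le (h01 ξ) (h01 (-η))).1 hη
        have : reducedFlux f c (φ (-η)) ≤ reducedFlux f c x := hmax ⟨this, (h01 _).2⟩
        linarith) (-diffusionPrimitive D 1)
    exact absurd hη (not_lt.2 (neg_le_neg (hup (-η))))

theorem monotone_of_hasDerivAt (hf : FluxCondition f) (hD : DiffusivityCondition D)
    (h01 : ∀ ξ, φ ξ ∈ Icc (0 : ℝ) 1)
    (hd : ∀ ξ, HasDerivAt (fun η => diffusionPrimitive D (φ η)) (reducedFlux f c (φ ξ) - K) ξ) :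
    Monotone φ := by
  have hm : Monotone fun η => diffusionPrimitive D (φ η) :=
    monotone_of_deriv_nonneg (fun ξ => (hd ξ).differentiableAt) fun ξ => by
      rw [(hd ξ).deriv]; exact reducedFlux_sub_nonneg hf hD h01 hd ξ
  exact fun x y hxy => (hD.strictMonoOn_primitive.le_iff_le (h01 x) (h01 y)).1 (hm hxy)

theorem IsProfile.monotone (hf : FluxCondition f) (hD : DiffusivityCondition D)
    (hφ : IsProfile f D c lm lp φ) : Monotone φ :=
  monotone_of_hasDerivAt hf hD hφ.mem_Icc hφ.equation

/-- A function cannot converge at `+∞` if its derivative has a non-zero limit there. -/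
theorem eq_zero_of_tendsto_of_tendsto_deriv {v v' : ℝ → ℝ} {a b : ℝ}
    (hv : ∀ ξ, HasDerivAt v (v' ξ) ξ) (ha : Tendsto v atTop (𝓝 a))
    (hb : Tendsto v' atTop (𝓝 b)) : b = 0 := by
  have h1 : ∀ ξ, ∃ η ∈ Ioo ξ (ξ + 1), v' η = v (ξ + 1) - v ξ := fun ξ => by
    obtain ⟨η, hη, h⟩ := exists_hasDerivAt_eq_slope v v' (lt_add_one ξ)
      (fun x _ => (hv x).continuousAt.continuousWithinAt) (fun x _ => hv x)
    exact ⟨η, hη, by simpa using h⟩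
  choose η hη hη' using h1
  have h2 : Tendsto η atTop atTop :=
    tendsto_atTop_mono (fun ξ => (hη ξ).1.le) tendsto_id
  have h3 : Tendsto (fun ξ => v (ξ + 1) - v ξ) atTop (𝓝 (a - a)) :=
    (ha.comp (tendsto_atTop_add_const_right _ _ tendsto_id)).sub ha
  rw [sub_self] at h3
  exact tendsto_nhds_unique (hb.comp h2) (h3.congr fun ξ => (hη' ξ).symm)

/-- A non-constant weak profile increases between two end states, at which the reduced flux takes
the same value. -/
theorem IsWeakProfile.exists_isProfile (hf : FluxCondition f) (hD : DiffusivityCondition D)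
    (hφ : IsWeakProfile f D c φ) (hnc : ¬ ∃ a, ∀ ξ, φ ξ = a) :
    ∃ lm lp, lm ∈ Icc (0 : ℝ) 1 ∧ lp ∈ Icc (0 : ℝ) 1 ∧ lm < lp ∧
      reducedFlux f c lm = reducedFlux f c lp ∧ IsProfile f D c lm lp φ := by
  obtain ⟨K, hd⟩ := hφ.exists_hasDerivAt hf hD
  have hm : Monotone φ := monotone_of_hasDerivAt hf hD hφ.mem_Icc hd
  have hba : BddAbove (range φ) := ⟨1, by rintro _ ⟨ξ, rfl⟩; exact (hφ.mem_Icc ξ).2⟩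
  have hbb : BddBelow (range φ) := ⟨0, by rintro _ ⟨ξ, rfl⟩; exact (hφ.mem_Icc ξ).1⟩
  have htop := tendsto_atTop_ciSup hm hba
  have hbot := tendsto_atBot_ciInf hm hbb
  set lp := ⨆ ξ, φ ξ
  set lm := ⨅ ξ, φ ξ
  have hlp : lp ∈ Icc (0 : ℝ) 1 := isClosed_Icc.mem_of_tendsto htop (.of_forall hφ.mem_Icc)
  have hlm : lm ∈ Icc (0 : ℝ) 1 := isClosed_Icc.mem_of_tendsto hbot (.of_forall hφ.mem_Icc)
  have hlt : lm < lp := by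
    refine lt_of_le_of_ne ((ciInf_le hbb 0).trans (le_ciSup hba 0)) fun heq => hnc ⟨lm, fun ξ => ?_⟩
    exact le_antisymm ((le_ciSup hba ξ).trans heq.ge) (ciInf_le hbb ξ)
  have hwith : ∀ {u : ℝ → ℝ} {l : Filter ℝ} {a : ℝ}, ContinuousOn u (Icc 0 1) →
      a ∈ Icc (0 : ℝ) 1 → Tendsto φ l (𝓝 a) → Tendsto (fun ξ => u (φ ξ)) l (𝓝 (u a)) :=
    fun hu ha hl => (hu _ ha).tendsto.comp
      (tendsto_nhdsWithin_iff.2 ⟨hl, .of_forall hφ.mem_Icc⟩)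
  have hg := hf.continuousOn_reducedFlux c
  have e1 : reducedFlux f c lp - K = 0 :=
    eq_zero_of_tendsto_of_tendsto_deriv hd (hwith hD.continuousOn_primitive hlp htop)
      ((hwith hg hlp htop).sub_const K)
  have e2 : -(reducedFlux f c lm - K) = 0 :=
    eq_zero_of_tendsto_of_tendsto_deriv (v := fun ξ => diffusionPrimitive D (φ (-ξ)))
      (v' := fun ξ => -(reducedFlux f c (φ (-ξ)) - K))
      (fun ξ => by simpa [Function.comp_def] using (hd (-ξ)).scomp ξ (hasDerivAt_neg ξ))
      ((hwith hD.continuousOn_primitive hlm hbot).comp tendsto_neg_atTop_atBot)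
      ((((hwith hg hlm hbot).comp tendsto_neg_atTop_atBot).sub_const K).neg)
  have hK : reducedFlux f c lm = K := by linarith
  exact ⟨lm, lp, hlm, hlp, hlt, by linarith, hφ.mem_Icc, hφ.continuous, hbot, htop,
    fun ξ => hK ▸ hd ξ⟩

/-! ### Pointwise form of the profile equation -/

theorem DiffusivityCondition.continuousAt (hD : DiffusivityCondition D) {u : ℝ}
    (hu : u ∈ Ioo (0 : ℝ) 1) : ContinuousAt D u :=
  hD.contDiffOn.continuousOn.continuousAt (Icc_mem_nhds hu.1 hu.2)

theorem DiffusivityCondition.eq_zero_or_eq_one (hD : DiffusivityCondition D) {u : ℝ}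
    (hu : u ∈ Icc (0 : ℝ) 1) (h0 : D u = 0) : u = 0 ∨ u = 1 := by
  by_contra! h
  exact (hD.pos u ⟨lt_of_le_of_ne hu.1 (Ne.symm h.1), lt_of_le_of_ne hu.2 h.2⟩).ne' h0

theorem DiffusivityCondition.hasDerivAt_of_hasDerivAt_comp (hD : DiffusivityCondition D)
    (hφ : Continuous φ) {ξ a : ℝ} (hξ : φ ξ ∈ Ioo (0 : ℝ) 1)
    (h : HasDerivAt (fun η => diffusionPrimitive D (φ η)) a ξ) :
    HasDerivAt φ (a / D (φ ξ)) ξ := by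
  have hne : D (φ ξ) ≠ 0 := (hD.pos _ hξ).ne'
  have hs : HasStrictDerivAt (diffusionPrimitive D) (D (φ ξ)) (φ ξ) :=
    hasStrictDerivAt_of_hasDerivAt_of_continuousAt
      (by filter_upwards [Ioo_mem_nhds hξ.1 hξ.2] with u hu using hD.hasDerivAt_primitive hu)
      (hD.continuousAt hξ)
  have h1 := (hs.to_localInverse hne).hasDerivAt.scomp_of_eq ξ h rfl
  have h2 : φ =ᶠ[𝓝 ξ] hs.localInverse _ _ _ hne ∘ fun η => diffusionPrimitive D (φ η) := by
    filter_upwards [hφ.continuousAt.eventually (hs.eventually_left_inverse hne)] with η hη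
    exact hη.symm
  exact (h1.congr_of_eventuallyEq h2).congr_deriv (by rw [smul_eq_mul, div_eq_mul_inv])

/-- Where the profile takes one of the values `0` and `1` it has an extremum, so that its
derivative vanishes, or fails to exist and is `0` by convention. -/
theorem deriv_eq_zero_of_eq_zero_or_eq_one (h01 : ∀ ξ, φ ξ ∈ Icc (0 : ℝ) 1) {ξ : ℝ}
    (hξ : φ ξ = 0 ∨ φ ξ = 1) : deriv φ ξ = 0 := by
  rcases hξ with h | h
  · exact IsLocalMin.deriv_eq_zero (.of_forall fun η => h ▸ (h01 η).1)
  · exact IsLocalMax.deriv_eq_zero (.of_forall fun η => h ▸ (h01 η).2)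

theorem mem_Ioo_or_of_mem_Icc {u : ℝ} (hu : u ∈ Icc (0 : ℝ) 1) :
    u ∈ Ioo (0 : ℝ) 1 ∨ (u = 0 ∨ u = 1) := by
  rcases hu.1.eq_or_lt with h | h
  · exact .inr (.inl h.symm)
  · rcases hu.2.eq_or_lt with h' | h'
    · exact .inr (.inr h')
    · exact .inl ⟨h, h'⟩

namespace IsProfile

theorem hasDerivAt (hD : DiffusivityCondition D) (hφ : IsProfile f D c lm lp φ) {ξ : ℝ}
    (hξ : φ ξ ∈ Ioo (0 : ℝ) 1) :
    HasDerivAt φ ((reducedFlux f c (φ ξ) - reducedFlux f c lm) / D (φ ξ)) ξ :=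
  hD.hasDerivAt_of_hasDerivAt_comp hφ.continuous hξ (hφ.equation ξ)

theorem reducedFlux_eq_of_eq_zero_or_eq_one (hD : DiffusivityCondition D)
    (hφ : IsProfile f D c lm lp φ) {ξ : ℝ} (hξ : φ ξ = 0 ∨ φ ξ = 1) :
    reducedFlux f c (φ ξ) - reducedFlux f c lm = 0 := by
  have h0 : (0 : ℝ) ∈ Icc (0 : ℝ) 1 := by simp
  have h1 : (1 : ℝ) ∈ Icc (0 : ℝ) 1 := by simp
  rcases hξ with h | h
  · refine IsLocalMin.hasDerivAt_eq_zero (.of_forall fun η => ?_) (hφ.equation ξ)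
    rw [h]
    exact hD.strictMonoOn_primitive.monotoneOn h0 (hφ.mem_Icc η) (hφ.mem_Icc η).1
  · refine IsLocalMax.hasDerivAt_eq_zero (.of_forall fun η => ?_) (hφ.equation ξ)
    rw [h]
    exact hD.strictMonoOn_primitive.monotoneOn (hφ.mem_Icc η) h1 (hφ.mem_Icc η).2

/-- The profile equation holds at every point for `deriv φ`. -/
theorem mul_deriv (hD : DiffusivityCondition D) (hφ : IsProfile f D c lm lp φ) (ξ : ℝ) :
    D (φ ξ) * deriv φ ξ = reducedFlux f c (φ ξ) - reducedFlux f c lm := by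
  rcases mem_Ioo_or_of_mem_Icc (hφ.mem_Icc ξ) with h | h
  · rw [(hφ.hasDerivAt hD h).deriv, mul_div_cancel₀ _ (hD.pos _ h).ne']
  · rw [hφ.reducedFlux_eq_of_eq_zero_or_eq_one hD h, deriv_eq_zero_of_eq_zero_or_eq_one hφ.mem_Icc h,
      mul_zero]

theorem ite_div_eq_deriv (hD : DiffusivityCondition D) (hφ : IsProfile f D c lm lp φ) (ξ : ℝ) :
    (if D (φ ξ) = 0 then 0 else (reducedFlux f c (φ ξ) - reducedFlux f c lm) / D (φ ξ))
      = deriv φ ξ := by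
  split_ifs with h
  · exact (deriv_eq_zero_of_eq_zero_or_eq_one hφ.mem_Icc
      (hD.eq_zero_or_eq_one (hφ.mem_Icc ξ) h)).symm
  · rw [← hφ.mul_deriv hD ξ, mul_div_cancel_left₀ _ h]

theorem contDiffAt (hf : FluxCondition f) (hD : DiffusivityCondition D)
    (hφ : IsProfile f D c lm lp φ) {ξ : ℝ} (hξ : φ ξ ∈ Ioo (0 : ℝ) 1) : ContDiffAt ℝ 1 φ ξ := by
  have hU : IsOpen (φ ⁻¹' Ioo 0 1) := isOpen_Ioo.preimage hφ.continuous
  have hcd : ContDiffOn ℝ 1 φ (φ ⁻¹' Ioo 0 1) := by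
    refine (contDiffOn_succ_iff_deriv_of_isOpen (n := 0) hU).2 ⟨fun η hη =>
      (hφ.hasDerivAt hD hη).differentiableAt.differentiableWithinAt, by simp, ?_⟩
    rw [contDiffOn_zero]
    have hcont : ContinuousOn
        (fun η => (reducedFlux f c (φ η) - reducedFlux f c lm) / D (φ η)) (φ ⁻¹' Ioo 0 1) :=
      ((hf.continuous_reducedFlux_comp hφ.mem_Icc hφ.continuous).sub
        continuous_const).continuousOn.div
        (fun η hη => ((hD.continuousAt hη).comp hφ.continuous.continuousAt).continuousWithinAt)
        fun η hη => (hD.pos _ hη).ne'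
    exact hcont.congr fun η hη => (hφ.hasDerivAt hD hη).deriv
  exact hcd.contDiffAt (hU.mem_nhds hξ)

/-- A profile is monotone, so it can fail to be `C¹` only at the last point where it equals `0` and
at the first point where it equals `1`. -/
theorem countable_not_contDiffAt (hf : FluxCondition f) (hD : DiffusivityCondition D)
    (hφ : IsProfile f D c lm lp φ) : {ξ | ¬ ContDiffAt ℝ 1 φ ξ}.Countable := by
  have hm := hφ.monotone hf hD
  have h0 : {ξ | φ ξ = 0 ∧ ∀ η, ξ < η → φ η ≠ 0}.Subsingleton := fun x hx y hy => by
    rcases lt_trichotomy x y with h | h | h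
    · exact absurd hy.1 (hx.2 y h)
    · exact h
    · exact absurd hx.1 (hy.2 x h)
  have h1 : {ξ | φ ξ = 1 ∧ ∀ η, η < ξ → φ η ≠ 1}.Subsingleton := fun x hx y hy => by
    rcases lt_trichotomy x y with h | h | h
    · exact absurd hx.1 (hy.2 x h)
    · exact h
    · exact absurd hy.1 (hx.2 y h)
  refine (h0.countable.union h1.countable).mono fun ξ hξ => ?_
  rcases mem_Ioo_or_of_mem_Icc (hφ.mem_Icc ξ) with h | h | h
  · exact absurd (hφ.contDiffAt hf hD h) hξ
  · refine .inl ⟨h, fun η hη h' => hξ ?_⟩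
    refine (contDiffAt_const (c := (0 : ℝ))).congr_of_eventuallyEq ?_
    filter_upwards [Iio_mem_nhds hη] with y hy
    exact le_antisymm (h' ▸ hm (le_of_lt hy)) (hφ.mem_Icc y).1
  · refine .inr ⟨h, fun η hη h' => hξ ?_⟩
    refine (contDiffAt_const (c := (1 : ℝ))).congr_of_eventuallyEq ?_
    filter_upwards [Ioi_mem_nhds hη] with y hy
    exact le_antisymm (hφ.mem_Icc y).2 (h' ▸ hm (le_of_lt hy))

theorem ae_differentiableAt_mul (hf : FluxCondition f) (hD : DiffusivityCondition D)
    (hφ : IsProfile f D c lm lp φ) {a : ℝ} (ha : a ≠ 0) :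
    ∀ᵐ ξ : ℝ, DifferentiableAt ℝ φ (a * ξ) := by
  have := (hφ.countable_not_contDiffAt hf hD).preimage (mul_right_injective₀ ha)
  filter_upwards [this.ae_notMem volume] with ξ hξ
  by_contra hcon
  exact hξ fun h => hcon (h.differentiableAt (by simp))

/-! ### The parabolic flux along a traveling wave -/

theorem parabolicFlux_eq (hD : DiffusivityCondition D) (hφ : IsProfile f D c lm lp φ)
    {Ω : Set ℝ} {ρ : ℝ → ℝ → ℝ} (hρ : ∀ t, ∀ x ∈ Ω, ρ t x = φ (x - c * t)) {t x : ℝ}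
    (hx : x ∈ interior Ω) :
    parabolicFlux f D (ρ t x) (deriv (ρ t) x) = c * φ (x - c * t) + reducedFlux f c lm := by
  have hloc : ρ t =ᶠ[𝓝 x] fun y => φ (y - c * t) := by
    filter_upwards [mem_interior_iff_mem_nhds.1 hx] with y hy using hρ t y hy
  rw [hloc.deriv_eq, deriv_comp_sub_const, hloc.eq_of_nhds, parabolicFlux, hφ.mul_deriv hD,
    reducedFlux]
  ring

theorem tendsto_parabolicFlux (hD : DiffusivityCondition D) (hφ : IsProfile f D c lm lp φ)
    {Ω s : Set ℝ} {ρ : ℝ → ℝ → ℝ} (hρ : ∀ t, ∀ x ∈ Ω, ρ t x = φ (x - c * t))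
    (hs : s ⊆ interior Ω) (t : ℝ) :
    Tendsto (fun x => parabolicFlux f D (ρ t x) (deriv (ρ t) x)) (𝓝[s] 0)
      (𝓝 (c * φ (c * -t) + reducedFlux f c lm)) := by
  have h1 : Tendsto (fun x => c * φ (x - c * t) + reducedFlux f c lm) (𝓝[s] 0)
      (𝓝 (c * φ (c * -t) + reducedFlux f c lm)) := by
    have hc : Continuous fun x => c * φ (x - c * t) + reducedFlux f c lm := by
      have := hφ.continuous
      fun_prop
    have := hc.tendsto 0
    rw [zero_sub, ← mul_neg] at this
    exact this.mono_left nhdsWithin_le_nhds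
  refine h1.congr' ?_
  filter_upwards [self_mem_nhdsWithin] with x hx
  exact (hφ.parabolicFlux_eq hD hρ (hs hx)).symm

end IsProfile

/-! ### Profiles give traveling waves -/

theorem integral_mul_fderiv_eq_neg_of_hasLineDerivAt {u u' ψ : ℝ × ℝ → ℝ} {v : ℝ × ℝ}
    (hu : Continuous u) (hu' : Continuous u') (h : ∀ p, HasLineDerivAt ℝ u (u' p) p v)
    (hψ : ContDiff ℝ ∞ ψ) (hc : HasCompactSupport ψ) :
    ∫ p, u p * fderiv ℝ ψ p v = - ∫ p, u' p * ψ p := by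
  have hψ' : Continuous fun p => fderiv ℝ ψ p v :=
    (hψ.continuous_fderiv (by simp)).clm_apply continuous_const
  exact integral_bilinear_hasLineDerivAt_right_eq_neg_left_of_integrable
    (B := ContinuousLinearMap.mul ℝ ℝ) (v := v) (f := u) (f' := u') (g := ψ)
    (g' := fun p => fderiv ℝ ψ p v) (μ := volume)
    ((hu'.mul hψ.continuous).integrable_of_hasCompactSupport hc.mul_left)
    ((hu.mul hψ').integrable_of_hasCompactSupport (hc.fderiv_apply ℝ v).mul_left)
    ((hu.mul hψ.continuous).integrable_of_hasCompactSupport hc.mul_left)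
    (fun p _ => h p)
    (fun p _ => ((hψ.differentiable (by simp) p).hasFDerivAt).hasLineDerivAt v)

namespace IsProfile

theorem isWeakProfile (hf : FluxCondition f) (hD : DiffusivityCondition D)
    (hφ : IsProfile f D c lm lp φ) : IsWeakProfile f D c φ := by
  have hw : Continuous fun ξ => reducedFlux f c (φ ξ) - reducedFlux f c lm :=
    (hf.continuous_reducedFlux_comp hφ.mem_Icc hφ.continuous).sub continuous_const
  have hP := hD.continuous_comp_primitive hφ.mem_Icc hφ.continuous
  have hint : ∀ (u ψ : ℝ → ℝ), Continuous u → Continuous ψ → HasCompactSupport ψ →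
      Integrable fun ξ => u ξ * ψ ξ := fun u ψ h1 h2 h3 =>
    (h1.mul h2).integrable_of_hasCompactSupport h3.mul_left
  refine ⟨hφ.mem_Icc, hφ.continuous, _, hw.locallyIntegrable, fun ψ hψ hc => ⟨?_, ?_⟩⟩
  · have hψ' : Continuous (deriv ψ) := hψ.continuous_deriv (by simp)
    exact integral_mul_deriv_eq_deriv_mul_of_integrable (fun x _ => hφ.equation x)
      (fun x _ => (hψ.differentiable (by simp) x).hasDerivAt)
      (hint _ _ hP hψ' hc.deriv) (hint _ _ hw hψ.continuous hc) (hint _ _ hP hψ.continuous hc)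
  · have hψ' : Continuous (deriv ψ) := hψ.continuous_deriv (by simp)
    have h0 : ∫ ξ, deriv ψ ξ = 0 :=
      integral_eq_zero_of_hasDerivAt_of_integrable
        (fun x => (hψ.differentiable (by simp) x).hasDerivAt)
        (hψ'.integrable_of_hasCompactSupport hc.deriv)
        (hψ.continuous.integrable_of_hasCompactSupport hc)
    simp only [sub_sub_cancel_left, integral_const_mul, h0, mul_zero]

theorem isWeakSolution (hf : FluxCondition f) (hD : DiffusivityCondition D)
    (hφ : IsProfile f D c lm lp φ) (Ω : Set ℝ) :
    IsWeakSolution f D Ω fun t x => φ (x - c * t) := by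
  have hshift : Continuous fun p : ℝ × ℝ => p.2 - c * p.1 := by fun_prop
  have hu : Continuous fun p : ℝ × ℝ => φ (p.2 - c * p.1) := hφ.continuous.comp hshift
  have hw : Continuous fun p : ℝ × ℝ =>
      reducedFlux f c (φ (p.2 - c * p.1)) - reducedFlux f c lm :=
    ((hf.continuous_reducedFlux_comp hφ.mem_Icc hφ.continuous).comp hshift).sub continuous_const
  have hP : Continuous fun p : ℝ × ℝ => diffusionPrimitive D (φ (p.2 - c * p.1)) :=
    (hD.continuous_comp_primitive hφ.mem_Icc hφ.continuous).comp hshift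
  refine ⟨fun t x _ => hφ.mem_Icc _, hu.continuousOn, ?_, _,
    hw.locallyIntegrable.locallyIntegrableOn _, fun ψ hψ hc hsupp => ?_⟩
  · refine ae_restrict_of_ae ?_
    have hN := hφ.countable_not_contDiffAt hf hD
    have hnull : ∀ᵐ p : ℝ × ℝ, p.2 - c * p.1 ∉ {ξ | ¬ ContDiffAt ℝ 1 φ ξ} := by
      rw [ae_iff]
      simp only [not_not]
      rw [Measure.volume_eq_prod]
      refine (Measure.measure_prod_null (hshift.measurable hN.measurableSet)).2
        (.of_forall fun t => ?_)
      exact (hN.preimage (f := fun x => x - c * t) sub_left_injective).measure_zero _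
    filter_upwards [hnull] with p hp
    have hp' : ContDiffAt ℝ 1 φ (p.2 - c * p.1) := not_not.1 hp
    exact hp'.comp p (f := fun p : ℝ × ℝ => p.2 - c * p.1) (by fun_prop)
  · have hout : ∀ p, p ∉ (univ : Set ℝ) ×ˢ interior Ω → ψ p = 0 ∧ fderiv ℝ ψ p = 0 :=
      fun p hp => ⟨image_eq_zero_of_notMem_tsupport fun h => hp (hsupp h),
        fderiv_of_notMem_tsupport ℝ fun h => hp (hsupp h)⟩
    have hψ' : ∀ v, Integrable fun p => fderiv ℝ ψ p v := fun v =>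
      ((hψ.continuous_fderiv (by simp)).clm_apply
        continuous_const).integrable_of_hasCompactSupport (hc.fderiv_apply ℝ v)
    constructor
    · rw [setIntegral_eq_integral_of_forall_compl_eq_zero fun p hp => by simp [hout p hp],
        setIntegral_eq_integral_of_forall_compl_eq_zero fun p hp => by simp [hout p hp]]
      refine integral_mul_fderiv_eq_neg_of_hasLineDerivAt hP hw (fun p => ?_) hψ hc
      have h1 := (hφ.equation (p.2 - c * p.1 + 0 * 1)).scomp_of_eq (0 : ℝ)
        (h := fun s : ℝ => p.2 - c * p.1 + s * 1)
        (((hasDerivAt_id (0 : ℝ)).mul_const 1).const_add _) rfl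
      simp only [add_zero, mul_one, one_smul] at h1
      refine h1.congr_of_eventuallyEq (.of_forall fun s => ?_)
      simp only [Function.comp_apply, Prod.snd_add, Prod.fst_add, Prod.smul_fst, Prod.smul_snd,
        smul_eq_mul, mul_zero, add_zero, mul_one]
      ring_nf
    · rw [setIntegral_eq_integral_of_forall_compl_eq_zero fun p hp => by simp [hout p hp]]
      -- `φ (x - c t)` is constant along the direction `(1, c)`
      have h1 : ∫ p : ℝ × ℝ, φ (p.2 - c * p.1) * fderiv ℝ ψ p (1, c) = 0 := by
        rw [integral_mul_fderiv_eq_neg_of_hasLineDerivAt (u' := fun _ => 0) hu continuous_const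
          (fun p => ?_) hψ hc]
        · simp
        · refine (hasDerivAt_const (0 : ℝ) (φ (p.2 - c * p.1))).congr_of_eventuallyEq
            (.of_forall fun s => ?_)
          simp only [Prod.snd_add, Prod.fst_add, Prod.smul_fst, Prod.smul_snd, smul_eq_mul,
            mul_one]
          ring_nf
      have h2 : ∫ p : ℝ × ℝ, reducedFlux f c lm * fderiv ℝ ψ p (0, 1) = 0 := by
        rw [integral_mul_fderiv_eq_neg_of_hasLineDerivAt (u' := fun _ => 0) continuous_const
          continuous_const (fun p => hasDerivAt_const _ _) hψ hc]
        simp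
      have hi : Integrable fun p : ℝ × ℝ => φ (p.2 - c * p.1) * fderiv ℝ ψ p (1, c) :=
        (hu.mul ((hψ.continuous_fderiv (by simp)).clm_apply
          continuous_const)).integrable_of_hasCompactSupport (hc.fderiv_apply ℝ _).mul_left
      have h3 := integral_add hi ((hψ' (0, 1)).const_mul (reducedFlux f c lm))
      rw [h1, h2, add_zero] at h3
      refine Eq.trans ?_ h3
      refine integral_congr_ae (.of_forall fun p => ?_)
      have hsplit : fderiv ℝ ψ p (1, c) = fderiv ℝ ψ p (1, 0) + c * fderiv ℝ ψ p (0, 1) := by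
        rw [← smul_eq_mul, ← map_smul, ← map_add]
        simp
      simp only [hsplit, reducedFlux]
      ring

theorem isTravelingWaveSolution (hf : FluxCondition f) (hD : DiffusivityCondition D)
    (hφ : IsProfile f D c lm lp φ) (hne : lm ≠ lp) (Ω : Set ℝ) :
    IsTravelingWaveSolution f D Ω (fun t x => φ (x - c * t)) φ c := by
  refine ⟨hφ.isWeakSolution hf hD Ω, fun _ _ _ => rfl, ?_, hφ.isWeakProfile hf hD⟩
  rintro ⟨a, ha⟩
  obtain rfl : φ = fun _ => a := funext ha
  exact hne ((tendsto_nhds_unique hφ.tendsto_atBot tendsto_const_nhds).trans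
    (tendsto_nhds_unique hφ.tendsto_atTop tendsto_const_nhds).symm)

end IsProfile

end SingleRoad

/-! ### Scaled profiles -/

theorem quasiMeasurePreserving_const_mul {a : ℝ} (ha : a ≠ 0) :
    Measure.QuasiMeasurePreserving (fun x : ℝ => a * x) volume volume := by
  refine ⟨measurable_const_mul a, ?_⟩
  rw [Real.map_volume_mul_left ha]
  exact Measure.smul_absolutelyContinuous

theorem ae_of_ae_const_mul {p : ℝ → Prop} {a : ℝ} (ha : a ≠ 0) (h : ∀ᵐ x : ℝ, p (a * x)) :
    ∀ᵐ x : ℝ, p x := by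
  filter_upwards [(quasiMeasurePreserving_const_mul (inv_ne_zero ha)).ae h] with x hx
  rwa [mul_inv_cancel_left₀ ha] at hx

theorem monotone_const_mul_comp_const_mul {φ : ℝ → ℝ} (hφ : Monotone φ) (a : ℝ) :
    Monotone fun ξ => a * φ (a * ξ) := by
  intro x y hxy
  rcases le_total 0 a with ha | ha
  · exact mul_le_mul_of_nonneg_left (hφ (mul_le_mul_of_nonneg_left hxy ha)) ha
  · exact mul_le_mul_of_nonpos_left (hφ (mul_le_mul_of_nonpos_left hxy ha)) ha

/-- A criterion for profiles: the equation need only hold almost everywhere, in its quotient form,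
for a function that is differentiable outside a countable set and whose values lie between the end
states. -/
theorem IsProfile.of_ae {f D φ d : ℝ → ℝ} {c lm lp : ℝ} {S : Set ℝ} (hf : FluxCondition f)
    (hD : DiffusivityCondition D) (hlm : lm ∈ Icc (0 : ℝ) 1) (hlp : lp ∈ Icc (0 : ℝ) 1)
    (hg : reducedFlux f c lp = reducedFlux f c lm) (hφ : Continuous φ)
    (hmem : ∀ ξ, φ ξ ∈ Icc lm lp) (hbot : Tendsto φ atBot (𝓝 lm)) (htop : Tendsto φ atTop (𝓝 lp))
    (hS : S.Countable) (hd : ∀ ξ ∉ S, HasDerivAt φ (d ξ) ξ)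
    (hae : ∀ᵐ ξ : ℝ, (if D (φ ξ) = 0 then 0
      else (reducedFlux f c (φ ξ) - reducedFlux f c lm) / D (φ ξ)) = d ξ) :
    IsProfile f D c lm lp φ := by
  have h01 : ∀ ξ, φ ξ ∈ Icc (0 : ℝ) 1 := fun ξ =>
    ⟨hlm.1.trans (hmem ξ).1, (hmem ξ).2.trans hlp.2⟩
  have hw : Continuous fun ξ => reducedFlux f c (φ ξ) - reducedFlux f c lm :=
    (hf.continuous_reducedFlux_comp h01 hφ).sub continuous_const
  have hP := hD.continuous_comp_primitive h01 hφ
  have hPd : ∀ ξ ∉ S, HasDerivAt (fun η => diffusionPrimitive D (φ η)) (D (φ ξ) * d ξ) ξ :=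
    fun ξ hξ => by
      have := (hD.hasDerivWithinAt_primitive (h01 ξ)).comp ξ ((hd ξ hξ).hasDerivWithinAt (s := univ))
        (fun η _ => h01 η)
      rwa [hasDerivWithinAt_univ] at this
  have hae' : ∀ᵐ ξ : ℝ, D (φ ξ) * d ξ = reducedFlux f c (φ ξ) - reducedFlux f c lm := by
    filter_upwards [hae] with ξ hξ
    rw [← hξ]
    split_ifs with h
    · -- `φ` takes the degenerate values `0` and `1` only if they are end states
      rcases hD.eq_zero_or_eq_one (h01 ξ) h with h0 | h1
      · have : φ ξ = lm := le_antisymm (h0 ▸ hlm.1) (hmem ξ).1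
        rw [this, sub_self, mul_zero]
      · have : φ ξ = lp := le_antisymm (hmem ξ).2 (h1 ▸ hlp.2)
        rw [this, hg, sub_self, mul_zero]
    · rw [mul_div_cancel₀ _ h]
  have hFTC : ∀ ξ, diffusionPrimitive D (φ ξ) =
      (∫ η in (0 : ℝ)..ξ, (reducedFlux f c (φ η) - reducedFlux f c lm))
        + diffusionPrimitive D (φ 0) := fun ξ => by
    have h1 := integral_eq_of_hasDerivAt_off_countable (a := 0) (b := ξ)
      (fun η => diffusionPrimitive D (φ η)) (fun η => D (φ η) * d η) hS hP.continuousOn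
      (fun x hx => hPd x hx.2)
      ((hw.intervalIntegrable 0 ξ).congr_ae (ae_restrict_of_ae
        (hae'.mono fun x hx => hx.symm)))
    rw [intervalIntegral.integral_congr_ae (hae'.mono fun x hx _ => hx)] at h1
    linarith
  refine ⟨h01, hφ, hbot, htop, fun ξ => ?_⟩
  exact (((hw.integral_hasStrictDerivAt 0 ξ).hasDerivAt).add_const
    (diffusionPrimitive D (φ 0))).congr_of_eventuallyEq (.of_forall hFTC)

/-! ### End states and candidate profiles in the network -/

section Network

variable {m n : ℕ} {f D : Fin m ⊕ Fin n → ℝ → ℝ} {α : Fin m → Fin n → ℝ}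
  {lm lp : Fin m ⊕ Fin n → ℝ} {φ : Fin m → ℝ → ℝ} {i : Fin m} {j : Fin n}

theorem reducedFlux_speed_eq {h : Fin m ⊕ Fin n} (hne : lm h ≠ lp h) :
    reducedFlux (f h) (speed f lm lp h) (lp h) = reducedFlux (f h) (speed f lm lp h) (lm h) := by
  have h1 : speed f lm lp h * (lp h - lm h) = f h (lp h) - f h (lm h) :=
    div_mul_cancel₀ _ (sub_ne_zero.2 hne.symm)
  simp only [reducedFlux]
  linarith

theorem apply_Lplus (hne : lm (Sum.inl i) ≠ lp (Sum.inl i)) :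
    f (Sum.inl i) (Lplus f lm lp i j) = speed f lm lp (Sum.inl i) * Lplus f lm lp i j
      + reducedFlux (f (Sum.inl i)) (speed f lm lp (Sum.inl i)) (lm (Sum.inl i)) := by
  unfold Lplus
  split_ifs
  · rw [← reducedFlux_speed_eq hne, reducedFlux]; ring
  · rw [reducedFlux]; ring

theorem apply_Lminus (hne : lm (Sum.inl i) ≠ lp (Sum.inl i)) :
    f (Sum.inl i) (Lminus f lm lp i j) = speed f lm lp (Sum.inl i) * Lminus f lm lp i j
      + reducedFlux (f (Sum.inl i)) (speed f lm lp (Sum.inl i)) (lm (Sum.inl i)) := by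
  unfold Lminus
  split_ifs
  · rw [reducedFlux]; ring
  · rw [← reducedFlux_speed_eq hne, reducedFlux]; ring

theorem speed_mul_speedRatio (hj : speed f lm lp (Sum.inr j) ≠ 0) :
    speed f lm lp (Sum.inr j) * speedRatio f lm lp i j = speed f lm lp (Sum.inl i) :=
  mul_div_cancel₀ _ hj

theorem speedRatio_pos_iff (hj : speed f lm lp (Sum.inr j) ≠ 0)
    (hi : speed f lm lp (Sum.inl i) ≠ 0) : 0 < speedRatio f lm lp i j ↔
      0 ≤ speed f lm lp (Sum.inl i) * speed f lm lp (Sum.inr j) := by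
  rw [speedRatio, div_pos_iff, ← mul_pos_iff]
  exact ⟨le_of_lt, fun h => lt_of_le_of_ne h (mul_ne_zero hi hj).symm⟩

theorem tendsto_speed_mul_atTop {u : ℝ → ℝ} (hj : speed f lm lp (Sum.inr j) ≠ 0)
    (hbot : Tendsto u atBot (𝓝 (lm (Sum.inl i)))) (htop : Tendsto u atTop (𝓝 (lp (Sum.inl i)))) :
    Tendsto (fun ξ => speed f lm lp (Sum.inl i) * u (speedRatio f lm lp i j * ξ)) atTop
      (𝓝 (speed f lm lp (Sum.inl i) * Lplus f lm lp i j)) := by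
  by_cases hi : speed f lm lp (Sum.inl i) = 0
  · simp [hi]
  refine Tendsto.const_mul _ ?_
  unfold Lplus
  split_ifs with h
  · exact htop.comp (tendsto_id.const_mul_atTop ((speedRatio_pos_iff hj hi).2 h))
  · have hneg : speedRatio f lm lp i j < 0 := lt_of_le_of_ne
      (not_lt.1 fun h' => h ((speedRatio_pos_iff hj hi).1 h')) (div_ne_zero hi hj)
    exact hbot.comp (tendsto_id.const_mul_atTop_of_neg hneg)

theorem tendsto_speed_mul_atBot {u : ℝ → ℝ} (hj : speed f lm lp (Sum.inr j) ≠ 0)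
    (hbot : Tendsto u atBot (𝓝 (lm (Sum.inl i)))) (htop : Tendsto u atTop (𝓝 (lp (Sum.inl i)))) :
    Tendsto (fun ξ => speed f lm lp (Sum.inl i) * u (speedRatio f lm lp i j * ξ)) atBot
      (𝓝 (speed f lm lp (Sum.inl i) * Lminus f lm lp i j)) := by
  by_cases hi : speed f lm lp (Sum.inl i) = 0
  · simp [hi]
  refine Tendsto.const_mul _ ?_
  unfold Lminus
  split_ifs with h
  · exact hbot.comp (tendsto_id.const_mul_atBot ((speedRatio_pos_iff hj hi).2 h))
  · have hneg : speedRatio f lm lp i j < 0 := lt_of_le_of_ne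
      (not_lt.1 fun h' => h ((speedRatio_pos_iff hj hi).1 h')) (div_ne_zero hi hj)
    exact htop.comp (tendsto_id.const_mul_atBot_of_neg hneg)

/-- Multiplied by `c_j`, the candidate profile becomes a sum over all incoming roads, since those
with zero speed contribute nothing. -/
theorem speed_mul_candidate (hj : speed f lm lp (Sum.inr j) ≠ 0) (ξ : ℝ) :
    speed f lm lp (Sum.inr j) * candidate f α lm lp φ j ξ =
      ∑ i, α i j * (speed f lm lp (Sum.inl i) * φ i (speedRatio f lm lp i j * ξ))
        - ∑ i, α i j * (speed f lm lp (Sum.inl i) * Lplus f lm lp i j)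
        + speed f lm lp (Sum.inr j) * lp (Sum.inr j) := by
  have hsum : ∀ u : Fin m → ℝ,
      speed f lm lp (Sum.inr j) * ∑ i ∈ movingIncoming f lm lp, coeffA f α lm lp i j * u i =
        ∑ i, α i j * (speed f lm lp (Sum.inl i) * u i) := fun u => by
    rw [Finset.mul_sum, movingIncoming, Finset.sum_filter]
    refine Finset.sum_congr rfl fun i _ => ?_
    split_ifs with hi
    · rw [coeffA, ← speed_mul_speedRatio (i := i) hj]; ring
    · rw [not_not.1 hi]; ring
  rw [candidate, coeffK, mul_sub, mul_sub, hsum, hsum]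
  ring

theorem hasDerivAt_candidate {ξ : ℝ}
    (h : ∀ i ∈ movingIncoming f lm lp, DifferentiableAt ℝ (φ i) (speedRatio f lm lp i j * ξ)) :
    HasDerivAt (candidate f α lm lp φ j) (∑ i ∈ movingIncoming f lm lp,
      coeffA f α lm lp i j * speedRatio f lm lp i j *
        deriv (φ i) (speedRatio f lm lp i j * ξ)) ξ := by
  have h1 : HasDerivAt (fun η => ∑ i ∈ movingIncoming f lm lp,
      coeffA f α lm lp i j * φ i (speedRatio f lm lp i j * η)) (∑ i ∈ movingIncoming f lm lp,
      coeffA f α lm lp i j * speedRatio f lm lp i j *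
        deriv (φ i) (speedRatio f lm lp i j * ξ)) ξ := by
    refine HasDerivAt.fun_sum fun i hi => ?_
    have := ((h i hi).hasDerivAt.scomp ξ
      ((hasDerivAt_id ξ).const_mul (speedRatio f lm lp i j))).const_mul (coeffA f α lm lp i j)
    refine this.congr_deriv ?_
    simp only [smul_eq_mul]
    ring
  exact h1.sub_const _

theorem monotone_candidate (hα : ∀ i, 0 ≤ α i j) (hφ : ∀ i, Monotone (φ i)) :
    Monotone (candidate f α lm lp φ j) := by
  intro x y hxy
  refine sub_le_sub_right (Finset.sum_le_sum fun i _ => ?_) _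
  simp only [coeffA, mul_assoc]
  exact mul_le_mul_of_nonneg_left
    (monotone_const_mul_comp_const_mul (hφ i) (speedRatio f lm lp i j) hxy) (hα i)

/-! ### From traveling waves to the algebraic condition -/

theorem mem_movingIncoming : i ∈ movingIncoming f lm lp ↔ speed f lm lp (Sum.inl i) ≠ 0 := by
  simp [movingIncoming]

theorem interior_road (h : Fin m ⊕ Fin n) :
    interior (road h) = Sum.elim (fun _ => Iio 0) (fun _ => Ioi 0) h := by
  cases h <;> simp [road]

theorem ae_differentiableAt_of_mem_movingIncoming (hf : ∀ h, FluxCondition (f h))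
    (hD : ∀ h, DiffusivityCondition (D h))
    (hφ : ∀ i, IsProfile (f (Sum.inl i)) (D (Sum.inl i)) (speed f lm lp (Sum.inl i))
      (lm (Sum.inl i)) (lp (Sum.inl i)) (φ i)) :
    ∀ᵐ ξ : ℝ, ∀ i ∈ movingIncoming f lm lp,
      DifferentiableAt ℝ (φ i) (speed f lm lp (Sum.inl i) * ξ) := by
  rw [eventually_all]
  intro i
  by_cases hi : speed f lm lp (Sum.inl i) = 0
  · exact .of_forall fun ξ h => absurd hi (mem_movingIncoming.1 h)
  · filter_upwards [(hφ i).ae_differentiableAt_mul (hf _) (hD _) hi] with ξ hξ _ using hξ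

/-- If the traces of the flux are conserved, the profiles satisfy an identity at every time. -/
theorem FluxConservation.flux_eq {ρ : Fin m ⊕ Fin n → ℝ → ℝ → ℝ} {φ : Fin m ⊕ Fin n → ℝ → ℝ}
    {c : Fin m ⊕ Fin n → ℝ} (hD : ∀ h, DiffusivityCondition (D h))
    (hφ : ∀ h, IsProfile (f h) (D h) (c h) (lm h) (lp h) (φ h))
    (hρ : ∀ h t, ∀ x ∈ road h, ρ h t x = φ h (x - c h * t))
    (hcons : FluxConservation f D α ρ) (j : Fin n) (s : ℝ) :
    c (Sum.inr j) * φ (Sum.inr j) (c (Sum.inr j) * s)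
        + reducedFlux (f (Sum.inr j)) (c (Sum.inr j)) (lm (Sum.inr j)) =
      ∑ i, α i j * (c (Sum.inl i) * φ (Sum.inl i) (c (Sum.inl i) * s)
        + reducedFlux (f (Sum.inl i)) (c (Sum.inl i)) (lm (Sum.inl i))) := by
  have hcont : ∀ h, Continuous fun t : ℝ => c h * φ h (c h * -t)
      + reducedFlux (f h) (c h) (lm h) := fun h => by
    have := (hφ h).continuous
    fun_prop
  have hall : (fun t : ℝ => c (Sum.inr j) * φ (Sum.inr j) (c (Sum.inr j) * -t)
        + reducedFlux (f (Sum.inr j)) (c (Sum.inr j)) (lm (Sum.inr j))) =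
      fun t => ∑ i, α i j * (c (Sum.inl i) * φ (Sum.inl i) (c (Sum.inl i) * -t)
        + reducedFlux (f (Sum.inl i)) (c (Sum.inl i)) (lm (Sum.inl i))) := by
    refine ((hcont _).ae_eq_iff_eq volume
      (continuous_finsetSum _ fun i _ => continuous_const.mul (hcont (Sum.inl i)))).1 ?_
    filter_upwards [hcons j] with t ⟨q, hq, hqj⟩
    have hi : ∀ i, q i = c (Sum.inl i) * φ (Sum.inl i) (c (Sum.inl i) * -t)
        + reducedFlux (f (Sum.inl i)) (c (Sum.inl i)) (lm (Sum.inl i)) := fun i =>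
      tendsto_nhds_unique (hq i) ((hφ (Sum.inl i)).tendsto_parabolicFlux (hD _) (hρ (Sum.inl i))
        (by rw [interior_road]; exact subset_rfl) t)
    rw [tendsto_nhds_unique ((hφ (Sum.inr j)).tendsto_parabolicFlux (hD _) (hρ (Sum.inr j))
        (by rw [interior_road]; exact subset_rfl) t) hqj]
    exact Finset.sum_congr rfl fun i _ => by rw [hi i]; rfl
  have := congrFun hall (-s)
  simpa only [neg_neg] using this

/-- The functions `c_i φ_i(c_i s)` are all non-decreasing, so they cannot compensate each other:
a positive combination of them is constant only if each of them is. -/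
theorem exists_sum_mul_ne {ι : Type*} [Fintype ι] {a c : ι → ℝ} {φ : ι → ℝ → ℝ}
    (ha : ∀ i, 0 < a i) (hφ : ∀ i, Monotone (φ i)) {i₀ : ι} (hc : c i₀ ≠ 0)
    (hnc : ¬ ∃ b, ∀ ξ, φ i₀ ξ = b) (C : ℝ) : ∃ s, ∑ i, a i * (c i * φ i (c i * s)) ≠ C := by
  by_contra! hcon
  have hconst : ∀ x y, x ≤ y → c i₀ * φ i₀ (c i₀ * y) = c i₀ * φ i₀ (c i₀ * x) := by
    intro x y hxy
    have hnn : ∀ i ∈ Finset.univ,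
        0 ≤ a i * (c i * φ i (c i * y)) - a i * (c i * φ i (c i * x)) := fun i _ =>
      sub_nonneg.2 (mul_le_mul_of_nonneg_left
        (monotone_const_mul_comp_const_mul (hφ i) (c i) hxy) (ha i).le)
    have hz : ∑ i, (a i * (c i * φ i (c i * y)) - a i * (c i * φ i (c i * x))) = 0 := by
      rw [Finset.sum_sub_distrib, hcon, hcon, sub_self]
    have := (Finset.sum_eq_zero_iff_of_nonneg hnn).1 hz i₀ (Finset.mem_univ _)
    exact mul_left_cancel₀ (ha i₀).ne' (sub_eq_zero.1 this)
  have hconst' : ∀ x y, φ i₀ (c i₀ * y) = φ i₀ (c i₀ * x) := fun x y => by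
    rcases le_total x y with h | h
    · exact mul_left_cancel₀ hc (hconst x y h)
    · exact (mul_left_cancel₀ hc (hconst y x h)).symm
  refine hnc ⟨φ i₀ (c i₀ * 0), fun ξ => ?_⟩
  rw [← hconst' 0 (ξ / c i₀), mul_div_cancel₀ _ hc]

theorem IsTravelingWave.conditionT {ρ : Fin m ⊕ Fin n → ℝ → ℝ → ℝ} {φ : Fin m ⊕ Fin n → ℝ → ℝ}
    {c : Fin m ⊕ Fin n → ℝ} (hf : ∀ h, FluxCondition (f h))
    (hD : ∀ h, DiffusivityCondition (D h)) (hα : ∀ i j, 0 < α i j)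
    (hw : IsTravelingWave f D α ρ φ c) (hns : ¬ IsStationary c) : ConditionT f D α := by
  choose lm lp hlm hlp hlt hg hφ using fun h =>
    (hw.travelingWaveSolution h).weakProfile.exists_isProfile (hf h) (hD h)
      (hw.travelingWaveSolution h).nonconstant
  obtain rfl : c = speed f lm lp := funext fun h => by
    rw [speed, eq_div_iff (sub_ne_zero.2 (hlt h).ne')]
    have := hg h
    simp only [reducedFlux] at this
    linarith
  have hflux := hw.fluxConservation.flux_eq hD hφ
    fun h => (hw.travelingWaveSolution h).eq_profile
  have hmono : ∀ h, Monotone (φ h) := fun h => (hφ h).monotone (hf h) (hD h)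
  have hnc : ∀ h, ¬ ∃ a, ∀ ξ, φ h ξ = a := fun h => (hw.travelingWaveSolution h).nonconstant
  have hmove : ∃ i, speed f lm lp (Sum.inl i) ≠ 0 := by
    by_contra! h0
    refine hns fun h => ?_
    rcases h with i | j
    · exact h0 i
    by_contra hj
    obtain ⟨s, hs⟩ := exists_sum_mul_ne (ι := Unit) (a := fun _ => 1)
      (c := fun _ => speed f lm lp (Sum.inr j)) (φ := fun _ => φ (Sum.inr j)) (i₀ := ())
      (fun _ => one_pos) (fun _ => hmono _) hj (hnc _)
      (∑ i, α i j * reducedFlux (f (Sum.inl i)) 0 (lm (Sum.inl i))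
        - reducedFlux (f (Sum.inr j)) (speed f lm lp (Sum.inr j)) (lm (Sum.inr j)))
    refine hs ?_
    have := hflux j s
    simp only [h0, zero_mul, zero_add] at this
    simp only [Finset.univ_unique, Finset.sum_singleton, one_mul]
    linarith
  obtain ⟨i₀, hi₀⟩ := hmove
  have hcj : ∀ j, speed f lm lp (Sum.inr j) ≠ 0 := by
    intro j hj
    obtain ⟨s, hs⟩ := exists_sum_mul_ne (fun i => hα i j)
      (fun i => hmono (Sum.inl i)) (c := fun i => speed f lm lp (Sum.inl i)) hi₀ (hnc _)
      (reducedFlux (f (Sum.inr j)) 0 (lm (Sum.inr j)) - ∑ i, α i j *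
        reducedFlux (f (Sum.inl i)) (speed f lm lp (Sum.inl i)) (lm (Sum.inl i)))
    refine hs ?_
    have := hflux j s
    simp only [hj, zero_mul, zero_add, mul_add, Finset.sum_add_distrib] at this
    linarith
  have hflux' : ∀ j ξ, speed f lm lp (Sum.inr j) * φ (Sum.inr j) ξ
        + reducedFlux (f (Sum.inr j)) (speed f lm lp (Sum.inr j)) (lm (Sum.inr j)) =
      ∑ i, α i j * (speed f lm lp (Sum.inl i) * φ (Sum.inl i) (speedRatio f lm lp i j * ξ)
        + reducedFlux (f (Sum.inl i)) (speed f lm lp (Sum.inl i)) (lm (Sum.inl i))) := by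
    intro j ξ
    have := hflux j (ξ / speed f lm lp (Sum.inr j))
    rw [mul_div_cancel₀ _ (hcj j)] at this
    rw [this]
    refine Finset.sum_congr rfl fun i _ => ?_
    rw [speedRatio, mul_div_assoc', div_mul_eq_mul_div]
  have hplus : ∀ j, f (Sum.inr j) (lp (Sum.inr j))
      = ∑ i, α i j * f (Sum.inl i) (Lplus f lm lp i j) := fun j => by
    have h1 : Tendsto (fun ξ => speed f lm lp (Sum.inr j) * φ (Sum.inr j) ξ
        + reducedFlux (f (Sum.inr j)) (speed f lm lp (Sum.inr j)) (lm (Sum.inr j))) atTop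
        (𝓝 (∑ i, α i j * f (Sum.inl i) (Lplus f lm lp i j))) := by
      simp only [hflux', apply_Lplus (hlt (Sum.inl _)).ne]
      exact tendsto_finsetSum _ fun i _ => ((tendsto_speed_mul_atTop (hcj j)
        (hφ (Sum.inl i)).tendsto_atBot (hφ (Sum.inl i)).tendsto_atTop).add_const _).const_mul _
    rw [tendsto_nhds_unique h1 (((hφ (Sum.inr j)).tendsto_atTop.const_mul _).add_const _),
      ← reducedFlux_speed_eq (hlt _).ne, reducedFlux]
    ring
  have hminus : ∀ j, f (Sum.inr j) (lm (Sum.inr j))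
      = ∑ i, α i j * f (Sum.inl i) (Lminus f lm lp i j) := fun j => by
    have h1 : Tendsto (fun ξ => speed f lm lp (Sum.inr j) * φ (Sum.inr j) ξ
        + reducedFlux (f (Sum.inr j)) (speed f lm lp (Sum.inr j)) (lm (Sum.inr j))) atBot
        (𝓝 (∑ i, α i j * f (Sum.inl i) (Lminus f lm lp i j))) := by
      simp only [hflux', apply_Lminus (hlt (Sum.inl _)).ne]
      exact tendsto_finsetSum _ fun i _ => ((tendsto_speed_mul_atBot (hcj j)
        (hφ (Sum.inl i)).tendsto_atBot (hφ (Sum.inl i)).tendsto_atTop).add_const _).const_mul _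
    rw [tendsto_nhds_unique h1 (((hφ (Sum.inr j)).tendsto_atBot.const_mul _).add_const _),
      reducedFlux]
    ring
  have hcand : ∀ j, candidate f α lm lp (fun i => φ (Sum.inl i)) j = φ (Sum.inr j) := by
    intro j
    funext ξ
    refine mul_left_cancel₀ (hcj j) ?_
    have h1 := hflux' j ξ
    have h2 := hplus j
    simp only [apply_Lplus (hlt (Sum.inl _)).ne] at h2
    simp only [mul_add, Finset.sum_add_distrib] at h1 h2
    have h3 := reducedFlux_speed_eq (f := f) (hlt (Sum.inr j)).ne
    rw [← h3] at h1
    rw [speed_mul_candidate (hcj j)]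
    simp only [reducedFlux] at h1 h2 ⊢
    linarith
  refine ⟨lm, lp, fun i => φ (Sum.inl i), fun i => ⟨hlm _, hlp _, hlt _⟩,
    ⟨i₀, mem_movingIncoming.2 hi₀⟩, fun j => ⟨hlm _, hlp _, hminus j, hplus j, fun heq => ?_⟩,
    fun i => hφ _, fun j => ?_⟩
  · exact hcj j (by rw [speed, heq, sub_self, zero_div])
  · filter_upwards [ae_differentiableAt_of_mem_movingIncoming hf hD fun i => hφ (Sum.inl i)]
      with ξ hξ
    have hr : ∀ i, speedRatio f lm lp i j * (speed f lm lp (Sum.inr j) * ξ)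
        = speed f lm lp (Sum.inl i) * ξ := fun i => by
      rw [← mul_assoc, mul_comm (speedRatio f lm lp i j), speed_mul_speedRatio (hcj j)]
    have hd := hasDerivAt_candidate (f := f) (α := α) (lm := lm) (lp := lp)
      (φ := fun i => φ (Sum.inl i)) (j := j) (ξ := speed f lm lp (Sum.inr j) * ξ)
      fun i hi => by rw [hr]; exact hξ i hi
    simp only [slope, (hφ (Sum.inl _)).ite_div_eq_deriv (hD _)]
    rw [hcand, (hφ (Sum.inr j)).ite_div_eq_deriv (hD _), ← hcand, hd.deriv]
    simp only [hr]

/-! ### From the algebraic condition to traveling waves -/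

theorem isProfile_candidate (hf : ∀ h, FluxCondition (f h))
    (hD : ∀ h, DiffusivityCondition (D h)) (hα : ∀ i, 0 ≤ α i j)
    (hφ : ∀ i, IsProfile (f (Sum.inl i)) (D (Sum.inl i)) (speed f lm lp (Sum.inl i))
      (lm (Sum.inl i)) (lp (Sum.inl i)) (φ i))
    (hlt : ∀ i : Fin m, lm (Sum.inl i) ≠ lp (Sum.inl i))
    (hlm : lm (Sum.inr j) ∈ Icc (0 : ℝ) 1) (hlp : lp (Sum.inr j) ∈ Icc (0 : ℝ) 1)
    (hne : lm (Sum.inr j) ≠ lp (Sum.inr j)) (hj : speed f lm lp (Sum.inr j) ≠ 0)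
    (hminus : f (Sum.inr j) (lm (Sum.inr j)) = ∑ i, α i j * f (Sum.inl i) (Lminus f lm lp i j))
    (hplus : f (Sum.inr j) (lp (Sum.inr j)) = ∑ i, α i j * f (Sum.inl i) (Lplus f lm lp i j))
    (hslope : ∀ᵐ ξ : ℝ, slope f D lm lp (Sum.inr j)
        (candidate f α lm lp φ j (speed f lm lp (Sum.inr j) * ξ))
      = ∑ i ∈ movingIncoming f lm lp, coeffA f α lm lp i j * speedRatio f lm lp i j *
          slope f D lm lp (Sum.inl i) (φ i (speed f lm lp (Sum.inl i) * ξ))) :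
    IsProfile (f (Sum.inr j)) (D (Sum.inr j)) (speed f lm lp (Sum.inr j))
      (lm (Sum.inr j)) (lp (Sum.inr j)) (candidate f α lm lp φ j) := by
  have hmono : Monotone (candidate f α lm lp φ j) :=
    monotone_candidate hα fun i => (hφ i).monotone (hf _) (hD _)
  have hdiv : ∀ {l : Filter ℝ} {a : ℝ},
      Tendsto (fun ξ => speed f lm lp (Sum.inr j) * candidate f α lm lp φ j ξ) l
        (𝓝 (speed f lm lp (Sum.inr j) * a)) → Tendsto (candidate f α lm lp φ j) l (𝓝 a) :=
    fun {l a} h => by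
      have := h.const_mul (speed f lm lp (Sum.inr j))⁻¹
      simpa only [inv_mul_cancel_left₀ hj] using this
  have htop : Tendsto (candidate f α lm lp φ j) atTop (𝓝 (lp (Sum.inr j))) := by
    refine hdiv ?_
    simp only [speed_mul_candidate hj]
    have := ((tendsto_finsetSum Finset.univ fun i _ => (tendsto_speed_mul_atTop (i := i) hj
      (hφ i).tendsto_atBot (hφ i).tendsto_atTop).const_mul (α i j)).sub_const
      (∑ i, α i j * (speed f lm lp (Sum.inl i) * Lplus f lm lp i j))).add_const
      (speed f lm lp (Sum.inr j) * lp (Sum.inr j))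
    simpa only [sub_self, zero_add] using this
  have hbot : Tendsto (candidate f α lm lp φ j) atBot (𝓝 (lm (Sum.inr j))) := by
    refine hdiv ?_
    simp only [speed_mul_candidate hj]
    have := ((tendsto_finsetSum Finset.univ fun i _ => (tendsto_speed_mul_atBot (i := i) hj
      (hφ i).tendsto_atBot (hφ i).tendsto_atTop).const_mul (α i j)).sub_const
      (∑ i, α i j * (speed f lm lp (Sum.inl i) * Lplus f lm lp i j))).add_const
      (speed f lm lp (Sum.inr j) * lp (Sum.inr j))
    convert this using 2
    have hs := reducedFlux_speed_eq (f := f) hne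
    simp only [apply_Lplus (hlt _), apply_Lminus (hlt _), mul_add,
      Finset.sum_add_distrib] at hplus hminus
    simp only [reducedFlux] at hs hplus hminus
    linarith
  have hcont : Continuous (candidate f α lm lp φ j) :=
    (continuous_finsetSum _ fun i _ => continuous_const.mul
      ((hφ i).continuous.comp (continuous_const_mul _))).sub continuous_const
  have hr : ∀ i ξ, speedRatio f lm lp i j * (speed f lm lp (Sum.inr j) * ξ)
      = speed f lm lp (Sum.inl i) * ξ := fun i ξ => by
    rw [← mul_assoc, mul_comm (speedRatio f lm lp i j), speed_mul_speedRatio hj]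
  refine IsProfile.of_ae (hf _) (hD _) hlm hlp (reducedFlux_speed_eq hne) hcont
    (fun ξ => ⟨hmono.le_of_tendsto hbot ξ, hmono.ge_of_tendsto htop ξ⟩) hbot htop
    (S := ⋃ i ∈ movingIncoming f lm lp,
      (fun ξ => speedRatio f lm lp i j * ξ) ⁻¹' {ξ | ¬ ContDiffAt ℝ 1 (φ i) ξ})
    ((movingIncoming f lm lp).countable_toSet.biUnion fun i hi =>
      ((hφ i).countable_not_contDiffAt (hf _) (hD _)).preimage
        (mul_right_injective₀ (div_ne_zero (mem_movingIncoming.1 hi) hj)))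
    (fun ξ hξ => hasDerivAt_candidate fun i hi => ?_) (ae_of_ae_const_mul hj ?_)
  · simp only [mem_iUnion, mem_preimage, mem_ofPred_eq, not_exists, not_not] at hξ
    exact (hξ i hi).differentiableAt (by simp)
  · filter_upwards [hslope] with ξ hξ
    simp only [slope, (hφ _).ite_div_eq_deriv (hD _)] at hξ
    simp only [hξ, hr]

theorem ConditionT.exists_isTravelingWave (hf : ∀ h, FluxCondition (f h))
    (hD : ∀ h, DiffusivityCondition (D h)) (hα : ∀ i j, 0 < α i j) (hT : ConditionT f D α) :
    ∃ (ρ : Fin m ⊕ Fin n → ℝ → ℝ → ℝ) (φ : Fin m ⊕ Fin n → ℝ → ℝ) (c : Fin m ⊕ Fin n → ℝ),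
      IsTravelingWave f D α ρ φ c ∧ ¬ IsStationary c := by
  obtain ⟨lm, lp, φ, hin, ⟨i₀, hi₀⟩, hout, hφ, hslope⟩ := hT
  have hnej : ∀ j : Fin n, lm (Sum.inr j) ≠ lp (Sum.inr j) := fun j h =>
    (hout j).2.2.2.2 (by rw [h])
  have hcj : ∀ j : Fin n, speed f lm lp (Sum.inr j) ≠ 0 := fun j =>
    div_ne_zero (sub_ne_zero.2 (hout j).2.2.2.2.symm) (sub_ne_zero.2 (hnej j).symm)
  have hne : ∀ h, lm h ≠ lp h := by
    rintro (i | j)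
    · exact (hin i).2.2.ne
    · exact hnej j
  set Φ : Fin m ⊕ Fin n → ℝ → ℝ := Sum.elim φ (candidate f α lm lp φ)
  have hΦ : ∀ h, IsProfile (f h) (D h) (speed f lm lp h) (lm h) (lp h) (Φ h) := by
    rintro (i | j)
    · exact hφ i
    · exact isProfile_candidate hf hD (fun i => (hα i j).le) hφ (fun i => hne _) (hout j).1
        (hout j).2.1 (hnej j) (hcj j) (hout j).2.2.1 (hout j).2.2.2.1 (hslope j)
  refine ⟨fun h t x => Φ h (x - speed f lm lp h * t), Φ, speed f lm lp,
    ⟨fun h => (hΦ h).isTravelingWaveSolution (hf h) (hD h) (hne h) _, fun j => .of_forall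
      fun t => ⟨fun i => speed f lm lp (Sum.inl i) * φ i (speed f lm lp (Sum.inl i) * -t)
        + reducedFlux (f (Sum.inl i)) (speed f lm lp (Sum.inl i)) (lm (Sum.inl i)),
      fun i => ?_, ?_⟩⟩, fun h => mem_movingIncoming.1 hi₀ (h _)⟩
  · exact (hΦ (Sum.inl i)).tendsto_parabolicFlux (hD _)
      (Ω := road (m := m) (n := n) (Sum.inl i)) (fun _ _ _ => rfl) (by rw [interior_road]; exact subset_rfl) t
  · have h1 := (hΦ (Sum.inr j)).tendsto_parabolicFlux (hD _)
      (Ω := road (m := m) (n := n) (Sum.inr j)) (s := Ioi 0)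
      (fun _ _ _ => rfl) (by rw [interior_road]; exact subset_rfl) t
    refine h1.mono_right (le_of_eq (congrArg 𝓝 ?_))
    have h2 := (hout j).2.2.2.1
    have h3 := reducedFlux_speed_eq (f := f) (hnej j)
    simp only [apply_Lplus (hne (Sum.inl _)), mul_add, Finset.sum_add_distrib] at h2
    show speed f lm lp (Sum.inr j) *
      candidate f α lm lp φ j (speed f lm lp (Sum.inr j) * -t) + _ = _
    rw [speed_mul_candidate (hcj j)]
    simp only [← mul_assoc (speedRatio f lm lp _ j), mul_comm (speedRatio f lm lp _ j),
      speed_mul_speedRatio (hcj j), mul_add, Finset.sum_add_distrib]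
    simp only [reducedFlux] at h2 h3 ⊢
    linarith

end Network

end StarGraph

end

theorem mainTheorem1 {m n : ℕ} (f D : Fin m ⊕ Fin n → ℝ → ℝ) (α : Fin m → Fin n → ℝ)
    (hf : ∀ h, StarGraph.FluxCondition (f h))
    (hD : ∀ h, StarGraph.DiffusivityCondition (D h))
    (hα : ∀ i j, α i j ∈ Set.Ioc (0 : ℝ) 1)
    (hα_sum : ∀ i, ∑ j, α i j = 1) :
    (∃ (ρ : Fin m ⊕ Fin n → ℝ → ℝ → ℝ) (φ : Fin m ⊕ Fin n → ℝ → ℝ) (c : Fin m ⊕ Fin n → ℝ),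
        StarGraph.IsTravelingWave f D α ρ φ c ∧ ¬ StarGraph.IsStationary c) ↔
      StarGraph.ConditionT f D α := by
  constructor
  · rintro ⟨ρ, φ, c, hw, hns⟩
    exact hw.conditionT hf hD (fun i j => (hα i j).1) hns
  · exact fun hT => hT.exists_isTravelingWave hf hD fun i j => (hα i j).1
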